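/- Work over $\mathbb{C}$. A smooth rational curve of degree $d$ in $\mathbb{P}^n$ is a curve $C\subset\mathbb{P}^n$ which is the image of a closed embedding $\mathbb{P}^1\hookrightarrow\mathbb{P}^n$ given by $n+1$ binary forms of degree $d$ without common zeros; it is nondegenerate if no hyperplane contains it. A line $L\subset\mathbb{P}^n$ is a $k$-secant line of $C$ if there is an effective divisor $D=q_1+\dots+q_k$ of degree $k$ on $C$ (the points $q_i$ need not be distinct) which is contained in $L$ as a subscheme, i.e. if the scheme $L\cap C$ has length at least $k$. (1) If $C\subset\mathbb{P}^4$ is a smooth nondegenerate rational curve of degree $5$, then $C$ has a unique $3$-secant line $L\subset\mathbb{P}^4$, and $L$ is not a $4$-secant line of $C$. (2) If $C\subset\mathbb{P}^3$ is a smooth rational curve of degree $5$, then $C$ has a one-parameter family of $3$-secant lines: the set of $3$-secant lines of $C$ is an irreducible Zariski closed subset of dimension $1$ of the Grassmannian of lines in $\mathbb{P}^3$. (3) If $C\subset\mathbb{P}^3$ is a smooth rational curve of degree $5$ and every $3$-secant line of $C$ is a $4$-secant line of $C$, then $C$ lies on a smooth quadric surface $Q\subset\mathbb{P}^3$ as a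 divisor of type $(1,4)$; that is, for a suitable isomorphism $\mathbb{P}^1\times\mathbb{P}^1\cong Q$ given by the two rulings, $C$ is the zero divisor of a bihomogeneous form of bidegree $(1,4)$. -/

import Mathlib

open MvPolynomial
open scoped LinearAlgebra.Projectivization

noncomputable section

/-- The complex projective space `ℙⁿ` of lines through the origin in `ℂⁿ⁺¹`. -/
abbrev PSpace (n : ℕ) : Type := ℙ ℂ (Fin (n + 1) → ℂ)

/-- The value at `x ∈ ℂ²` of an `(n+1)`-tuple of binary forms. -/
def evalForms {n : ℕ} (φ : Fin (n + 1) → MvPolynomial (Fin 2) ℂ) (x : Fin 2 → ℂ) :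
    Fin (n + 1) → ℂ :=
  fun i => eval x (φ i)

theorem evalForms_smul {n d : ℕ} {φ : Fin (n + 1) → MvPolynomial (Fin 2) ℂ}
    (h : ∀ i, (φ i).IsHomogeneous d) (t : ℂ) (x : Fin 2 → ℂ) :
    evalForms φ (t • x) = t ^ d • evalForms φ x := by
  funext i
  simp only [evalForms, Pi.smul_apply, smul_eq_mul, eval_eq', Finset.mul_sum]
  refine Finset.sum_congr rfl fun m hm => ?_
  have hd := h i (mem_support_iff.mp hm)
  rw [Finsupp.weight_apply, Finsupp.sum_fintype _ _ (by simp)] at hd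
  simp only [Pi.one_apply, smul_eq_mul, mul_one] at hd
  rw [← hd]
  simp only [mul_pow, Finset.prod_mul_distrib, Finset.prod_pow_eq_pow_sum]
  ring

/-- A morphism `ℙ¹ → ℙⁿ` of degree `d`, that is, one which pulls `𝒪(1)` back to `𝒪(d)`: it is
given by `n + 1` binary forms of degree `d` without a common zero on `ℙ¹`. -/
structure ProjLineMorphism (n d : ℕ) where
  /-- the coordinate forms -/
  form : Fin (n + 1) → MvPolynomial (Fin 2) ℂ
  homogeneous : ∀ i, (form i).IsHomogeneous d
  base_point_free : ∀ x : Fin 2 → ℂ, x ≠ 0 → evalForms form x ≠ 0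

/-- The map on points of a morphism `ℙ¹ → ℙⁿ`, `[x] ↦ [φ₀(x) : … : φₙ(x)]`. -/
def ProjLineMorphism.onPoints {n d : ℕ} (φ : ProjLineMorphism n d) : PSpace 1 → PSpace n :=
  Projectivization.lift
    (fun x : {v : Fin 2 → ℂ // v ≠ 0} =>
      Projectivization.mk ℂ (evalForms φ.form x.1) (φ.base_point_free x.1 x.2))
    (by
      rintro ⟨a, ha⟩ ⟨b, hb⟩ t hab
      have hab' : a = t • b := hab
      refine (Projectivization.mk_eq_mk_iff' ℂ _ _ _ _).2 ⟨t ^ d, ?_⟩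
      change t ^ d • evalForms φ.form b = evalForms φ.form a
      rw [hab', evalForms_smul φ.homogeneous])

/-- A smooth rational curve of degree `d` in `ℙⁿ`, given by a closed embedding `ℙ¹ ↪ ℙⁿ`
of degree `d`: a morphism which is injective on points and on tangent vectors.

By Euler's relation the differential of `[φ₀ : … : φₙ]` is injective at `[x]` if and only if the
two vectors `∂φ/∂x₀ (x)` and `∂φ/∂x₁ (x)` of `ℂⁿ⁺¹` are linearly independent. -/
structure SmoothRationalCurve (n d : ℕ) extends ProjLineMorphism n d where
  injective : Function.Injective toProjLineMorphism.onPoints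
  immersion : ∀ x : Fin 2 → ℂ, x ≠ 0 →
    LinearIndependent ℂ fun j : Fin 2 => evalForms (fun i => pderiv j (form i)) x

/-- Lines in `ℙⁿ`, that is, the points of the Grassmannian of two-dimensional linear subspaces
of `ℂⁿ⁺¹`. -/
def LineIn (n : ℕ) : Type :=
  {W : Submodule ℂ (Fin (n + 1) → ℂ) // Module.finrank ℂ W = 2}

namespace LineIn

/-- The Plücker coordinates `vᵢ wⱼ - vⱼ wᵢ` of the line spanned by `v` and `w`. -/
def pluecker {n : ℕ} (v w : Fin (n + 1) → ℂ) : Fin (n + 1) × Fin (n + 1) → ℂ :=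
  fun p => v p.1 * w p.2 - v p.2 * w p.1

/-- The homogeneous polynomial `F` vanishes at the Plücker coordinates of the line `L`. -/
def Vanishes {n : ℕ} (F : MvPolynomial (Fin (n + 1) × Fin (n + 1)) ℂ) (L : LineIn n) : Prop :=
  ∀ v ∈ L.1, ∀ w ∈ L.1, LinearIndependent ℂ ![v, w] → eval (pluecker v w) F = 0

/-- The Zariski topology of the Grassmannian in its Plücker embedding: the sets where one
homogeneous polynomial in the Plücker coordinates does not vanish are a basis of it. -/
instance zariskiTopology (n : ℕ) : TopologicalSpace (LineIn n) :=
  TopologicalSpace.generateFrom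
    {U | ∃ (F : MvPolynomial (Fin (n + 1) × Fin (n + 1)) ℂ) (e : ℕ),
      F.IsHomogeneous e ∧ U = {L | ¬ Vanishes F L}}

end LineIn

namespace SmoothRationalCurve

variable {n d : ℕ}

/-- The set of points of the curve. -/
def points (C : SmoothRationalCurve n d) : Set (PSpace n) :=
  Set.range C.toProjLineMorphism.onPoints

/-- The curve is not contained in a hyperplane. -/
def Nondegenerate (C : SmoothRationalCurve n d) : Prop :=
  ∀ ℓ : Module.Dual ℂ (Fin (n + 1) → ℂ), ℓ ≠ 0 → ∃ P ∈ C.points, ℓ P.rep ≠ 0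

/-- The restriction to `C ≅ ℙ¹` of a linear form on `ℙⁿ`, a binary form of degree `d`. -/
def restrict (C : SmoothRationalCurve n d) (ℓ : Module.Dual ℂ (Fin (n + 1) → ℂ)) :
    MvPolynomial (Fin 2) ℂ :=
  ∑ i, MvPolynomial.C (ℓ (Pi.single i 1)) * C.form i

/-- `L` is a `k`-secant line of `C`: there is an effective divisor `D` of degree `k` on `C` which
is contained, as a subscheme, in `L`; that is, the scheme `L ∩ C` has length at least `k`.
The effective divisors of degree `k` on `C ≅ ℙ¹` are the zero divisors of the nonzero binary forms
`g` of degree `k`, and `D` is contained in `L` if and only if the restriction to `C` of each linear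
form which vanishes on `L` is divisible by `g`. -/
def IsSecant (C : SmoothRationalCurve n d) (k : ℕ) (L : LineIn n) : Prop :=
  ∃ g : MvPolynomial (Fin 2) ℂ, g ≠ 0 ∧ g.IsHomogeneous k ∧
    ∀ ℓ ∈ L.1.dualAnnihilator, g ∣ C.restrict ℓ

/-- The set of `k`-secant lines of `C`, a subset of the Grassmannian of lines. -/
def secantLines (C : SmoothRationalCurve n d) (k : ℕ) : Set (LineIn n) :=
  {L | C.IsSecant k L}

end SmoothRationalCurve

/-- `q` is the equation of a smooth quadric surface in `ℙ³` (Jacobian criterion). -/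
def IsSmoothQuadric (q : MvPolynomial (Fin 4) ℂ) : Prop :=
  q.IsHomogeneous 2 ∧
    ∀ x : Fin 4 → ℂ, x ≠ 0 → eval x q = 0 → ∃ i, eval x (pderiv i q) ≠ 0

/-- The linear isomorphism `A` carries the Segre surface, the quadric of the `2 × 2` matrices of
determinant zero, to the quadric surface `q = 0`. Then `([x], [y]) ↦ [A (x yᵀ)]` is an isomorphism
from `ℙ¹ × ℙ¹` to the quadric, and the images of the two families of fibres are its rulings. -/
def IsSegreCoordinates (q : MvPolynomial (Fin 4) ℂ)
    (A : Matrix (Fin 2) (Fin 2) ℂ ≃ₗ[ℂ] (Fin 4 → ℂ)) : Prop :=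
  ∀ M : Matrix (Fin 2) (Fin 2) ℂ, eval (A M) q = 0 ↔ M.det = 0

/-- `F(x, y)` is bihomogeneous, of degree `a` in `x = (x₀, x₁)` and `b` in `y = (y₀, y₁)`. -/
def IsBihomogeneous (F : MvPolynomial (Fin 2 ⊕ Fin 2) ℂ) (a b : ℕ) : Prop :=
  F.IsWeightedHomogeneous (Sum.elim (fun _ => 1) (fun _ => 0) : Fin 2 ⊕ Fin 2 → ℕ) a ∧
  F.IsWeightedHomogeneous (Sum.elim (fun _ => 0) (fun _ => 1) : Fin 2 ⊕ Fin 2 → ℕ) b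

/-- The reduced curve with point set `S` lies on the smooth quadric surface `q = 0` in `ℙ³` as a
divisor of type `(a, b)`, for a suitable ordering of the two rulings: under an isomorphism of
`ℙ¹ × ℙ¹` with the quadric it is the zero divisor of a bihomogeneous form of bidegree `(a, b)`.
The form is squarefree, so that its zero divisor is reduced. -/
def IsDivisorOfType (q : MvPolynomial (Fin 4) ℂ) (S : Set (PSpace 3)) (a b : ℕ) : Prop :=
  (∀ P ∈ S, eval P.rep q = 0) ∧
  ∃ A : Matrix (Fin 2) (Fin 2) ℂ ≃ₗ[ℂ] (Fin 4 → ℂ), IsSegreCoordinates q A ∧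
    ∃ F : MvPolynomial (Fin 2 ⊕ Fin 2) ℂ, IsBihomogeneous F a b ∧ Squarefree F ∧
      ∀ (x y : Fin 2 → ℂ) (_ : x ≠ 0) (_ : y ≠ 0)
        (h : A (Matrix.vecMulVec x y) ≠ 0),
        eval (Sum.elim x y) F = 0 ↔ Projectivization.mk ℂ (A (Matrix.vecMulVec x y)) h ∈ S

end

/-!
A map `ℙ¹ → ℙⁿ` of degree `d` is the rational normal curve of degree `d`, in the space of
functionals on binary forms of degree `d`, followed by the linear projection `T` with kernel `K`.
A nonzero form `g` of degree `k` kills the span of its zero divisor on the rational normal curve,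
the annihilator of the multiples of `g`; the line `L` is `k`-secant along `g` if and only if `T`
maps this annihilator into `L`, and the map is a closed embedding if and only if no nonzero
functional in `K` annihilates the multiples of a quadratic form.

For `d = 5` every functional annihilates the multiples of some cubic form, which is unique up to
scalars on `K ∖ 0`, so that the trisecant lines correspond to the points of `ℙ(K)`. For a
nondegenerate curve in `ℙ⁴` this is one point. A curve in `ℙ³` is nondegenerate, since Hopf's
theorem on nonsingular bilinear maps bounds the dimension of `K` by two; hence `ℙ(K)` is a pencil,
and the trisecant lines are an irreducible one-dimensional family, which is closed because the
existence of a common cubic factor is a determinantal condition on Sylvester matrices.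

If all trisecant lines are four-secant, then two of them give quartic forms `f₀`, `f₁` whose
multiples are annihilated by all of `K`. They have no common cubic factor, since the two lines are
distinct. Therefore contraction with `f₀` and `f₁` is a linear map to `2 × 2` matrices with the same
kernel as `T`, and up to a linear change of coordinates the curve is `[y] ↦ [f(y) yᵀ]` on the Segre
quadric, with the equation `x₀ f₁(y) = x₁ f₀(y)`.
-/

noncomputable section

/-! ### Hopf's theorem on nonsingular bilinear maps -/

section Hopf

variable {k ι κ τ : Type*} [Field k] [Fintype ι] [Fintype κ]

/-- The bilinear form `∑ cᵢⱼ xᵢ yⱼ`, as a polynomial in two sets of variables. -/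
def bilinearPoly (c : ι → κ → k) : MvPolynomial (ι ⊕ κ) k :=
  ∑ i, ∑ j, C (c i j) * (X (Sum.inl i) * X (Sum.inr j))

theorem aeval_bilinearPoly {E : Type*} [CommRing E] [Algebra k E] (c : ι → κ → k) (x : ι → E)
    (y : κ → E) :
    aeval (Sum.elim x y) (bilinearPoly c) = ∑ i, ∑ j, algebraMap k E (c i j) * (x i * y j) := by
  simp [bilinearPoly]

theorem aeval_bilinearPoly_mul_mul {E : Type*} [CommRing E] [Algebra k E] (c : ι → κ → k)
    (a b : E) (x : ι → E) (y : κ → E) :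
    aeval (Sum.elim (fun i => a * x i) (fun j => b * y j)) (bilinearPoly c) =
      a * b * aeval (Sum.elim x y) (bilinearPoly c) := by
  simp only [aeval_bilinearPoly, Finset.mul_sum]
  exact Finset.sum_congr rfl fun i _ => Finset.sum_congr rfl fun j _ => by ring

/-- The bilinear map `(x, y) ↦ (∑ cₗᵢⱼ xᵢ yⱼ)ₗ` vanishes at `(x, y)` only if `x = 0` or `y = 0`. -/
def IsNonsingular (c : τ → ι → κ → k) : Prop :=
  ∀ (x : ι → k) (y : κ → k), (∀ l, ∑ i, ∑ j, c l i j * (x i * y j) = 0) → x = 0 ∨ y = 0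

theorem exists_pow_mem_span_bilinearPoly [IsAlgClosed k] {c : τ → ι → κ → k}
    (hc : IsNonsingular c) (i : ι) (j : κ) :
    ∃ N, (X (Sum.inl i) * X (Sum.inr j) : MvPolynomial (ι ⊕ κ) k) ^ N ∈
      Ideal.span (Set.range fun l => bilinearPoly (c l)) := by
  rw [← Ideal.mem_radical_iff, ← vanishingIdeal_zeroLocus_eq_radical (K := k),
    mem_vanishingIdeal_iff]
  intro z hz
  have hzero : ∀ l, aeval z (bilinearPoly (c l)) = 0 := fun l => hz _ (Ideal.subset_span ⟨l, rfl⟩)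
  obtain ⟨x, y, rfl⟩ : ∃ x y, z = Sum.elim x y := ⟨_, _, (Sum.elim_comp_inl_inr z).symm⟩
  simp only [aeval_bilinearPoly, Algebra.algebraMap_self_apply] at hzero
  obtain rfl | rfl := hc x y hzero <;> simp

variable [Finite τ] {E : Type*} [Field E] [Algebra k E]

theorem aeval_mem_of_algebraMap_mem {σ : Type*} {V : ValuationSubring E}
    (hk : ∀ a, algebraMap k E a ∈ V) {z : σ → E} (hz : ∀ i, z i ∈ V) (p : MvPolynomial σ k) :
    aeval z p ∈ V := by
  rw [aeval_def, eval₂_eq]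
  exact sum_mem fun _ _ => mul_mem (hk _) (prod_mem fun i _ => pow_mem (hz i) _)

theorem exists_one_le_valuation_bilinearPoly [IsAlgClosed k] {c : τ → ι → κ → k}
    (hc : IsNonsingular c) {V : ValuationSubring E} (hk : ∀ a, algebraMap k E a ∈ V)
    {z : ι ⊕ κ → E} (hz : ∀ s, z s ∈ V) {i : ι} {j : κ} (hi : z (Sum.inl i) = 1)
    (hj : z (Sum.inr j) = 1) : ∃ l, 1 ≤ V.valuation (aeval z (bilinearPoly (c l))) := by
  cases nonempty_fintype τ
  by_contra! hlt
  obtain ⟨N, hN⟩ := exists_pow_mem_span_bilinearPoly hc i j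
  obtain ⟨b, hb⟩ := Ideal.mem_span_range_iff_exists_fun.1 hN
  have hone : ∑ l, aeval z (b l) * aeval z (bilinearPoly (c l)) = 1 := by
    simpa [hi, hj] using congrArg (aeval z) hb
  refine (lt_irrefl (1 : V.ValueGroup)) ?_
  calc 1 = V.valuation (∑ l, aeval z (b l) * aeval z (bilinearPoly (c l))) := by
        rw [hone, map_one]
    _ < 1 := V.valuation.map_sum_lt one_ne_zero fun l _ => by
        rw [map_mul]
        exact (mul_le_of_le_one_left' ((V.valuation_le_one_iff _).2
          (aeval_mem_of_algebraMap_mem hk hz _))).trans_lt (hlt l)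

/-- After division by the entries of largest valuation, `x` and `y` specialise to nonzero vectors
over the residue field; if `xᵢ yⱼ` had a pole, they would be a common zero of the forms there. -/
theorem mul_mem_of_bilinearPoly_mem [IsAlgClosed k] {c : τ → ι → κ → k}
    (hc : IsNonsingular c)
    {V : ValuationSubring E} (hk : ∀ a, algebraMap k E a ∈ V) {x : ι → E} {y : κ → E}
    (hxy : ∀ l, aeval (Sum.elim x y) (bilinearPoly (c l)) ∈ V) (i : ι) (j : κ) :
    x i * y j ∈ V := by
  have : Nonempty ι := ⟨i⟩
  have : Nonempty κ := ⟨j⟩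
  obtain ⟨i₀, hi₀⟩ := Finite.exists_max fun i => V.valuation (x i)
  obtain ⟨j₀, hj₀⟩ := Finite.exists_max fun j => V.valuation (y j)
  suffices h : x i₀ * y j₀ ∈ V by
    rw [← V.valuation_le_one_iff, map_mul] at h ⊢
    exact (mul_le_mul' (hi₀ i) (hj₀ j)).trans h
  by_contra hpole
  have hx₀ : x i₀ ≠ 0 := by rintro h; exact hpole (by simp [h])
  have hy₀ : y j₀ ≠ 0 := by rintro h; exact hpole (by simp [h])
  have hmem : ∀ a b : E, V.valuation a ≤ V.valuation b → b⁻¹ * a ∈ V := by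
    intro a b hab
    rw [← V.valuation_le_one_iff, map_mul, map_inv₀]
    exact inv_mul_le_one_of_le₀ hab zero_le
  set z : ι ⊕ κ → E := Sum.elim (fun i => (x i₀)⁻¹ * x i) (fun j => (y j₀)⁻¹ * y j)
  have hz : ∀ s, z s ∈ V := by
    rintro (i | j)
    exacts [hmem _ _ (hi₀ i), hmem _ _ (hj₀ j)]
  obtain ⟨l, hl⟩ := exists_one_le_valuation_bilinearPoly hc hk hz (i := i₀) (j := j₀)
    (inv_mul_cancel₀ hx₀) (inv_mul_cancel₀ hy₀)
  refine hl.not_gt ?_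
  have hinv : V.valuation (x i₀ * y j₀)⁻¹ < 1 := by
    rw [map_inv₀]
    exact inv_lt_one_of_one_lt₀ (not_le.1 fun h => hpole ((V.valuation_le_one_iff _).1 h))
  rw [aeval_bilinearPoly_mul_mul, ← mul_inv, map_mul]
  exact (mul_le_of_le_one_right' ((V.valuation_le_one_iff _).2 (hxy l))).trans_lt hinv

theorem isIntegral_mul_of_bilinearPoly [IsAlgClosed k] {c : τ → ι → κ → k}
    (hc : IsNonsingular c) {R : Subalgebra k E}
    {x : ι → E} {y : κ → E} (hxy : ∀ l, aeval (Sum.elim x y) (bilinearPoly (c l)) ∈ R) (i : ι)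
    (j : κ) : IsIntegral R (x i * y j) := by
  have hmem : x i * y j ∈ (integralClosure (Subring.closure (R : Set E)) E).toSubring := by
    rw [← iInf_valuationSubring_superset, Subring.mem_iInf]
    rintro ⟨V, hV⟩
    exact mul_mem_of_bilinearPoly_mem hc (fun a => hV (R.algebraMap_mem a))
      (fun l => hV (hxy l)) i j
  have hcl : Subring.closure (R : Set E) = R.toSubring := Subring.closure_eq R.toSubring
  rw [hcl] at hmem
  exact hmem

theorem isAlgebraic_adjoin_of_bilinearPoly [IsAlgClosed k] {c : τ → ι → κ → k}
    (hc : IsNonsingular c)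
    {x : ι → E} {y : κ → E} (hE : IntermediateField.adjoin k (Set.range (Sum.elim x y)) = ⊤)
    {i₀ : ι} {j₀ : κ} (hx : x i₀ ≠ 0) (hy : y j₀ ≠ 0) :
    Algebra.IsAlgebraic (Algebra.adjoin k (insert (x i₀)
      (Set.range fun l => aeval (Sum.elim x y) (bilinearPoly (c l))))) E := by
  set S := insert (x i₀) (Set.range fun l => aeval (Sum.elim x y) (bilinearPoly (c l)))
  set F := IntermediateField.adjoin k S
  let Ω := algebraicClosure F E
  have hprod : ∀ i j, x i * y j ∈ Ω := fun i j => by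
    refine mem_algebraicClosure_iff'.2
      (isIntegral_mul_of_bilinearPoly (R := F.toSubalgebra) hc (fun l => ?_) i j)
    exact IntermediateField.subset_adjoin k S (Set.mem_insert_of_mem _ ⟨l, rfl⟩)
  have hx₀ : x i₀ ∈ Ω := Ω.algebraMap_mem
    ⟨x i₀, IntermediateField.subset_adjoin k S (Set.mem_insert _ _)⟩
  have hyΩ : ∀ j, y j ∈ Ω := fun j => by
    simpa [hx] using Ω.mul_mem (Ω.inv_mem hx₀) (hprod i₀ j)
  have hxΩ : ∀ i, x i ∈ Ω := fun i => by
    simpa [hy] using Ω.mul_mem (hprod i j₀) (Ω.inv_mem (hyΩ j₀))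
  have htop : ∀ e : E, e ∈ Ω := by
    intro e
    have hle : IntermediateField.adjoin k (Set.range (Sum.elim x y)) ≤ Ω.restrictScalars k := by
      rw [IntermediateField.adjoin_le_iff]
      rintro _ ⟨i | j, rfl⟩
      exacts [hxΩ i, hyΩ j]
    exact hle (hE ▸ IntermediateField.mem_top)
  exact IntermediateField.isAlgebraic_adjoin_iff_top.1
    ⟨fun e => mem_algebraicClosure_iff.1 (htop e)⟩

theorem adjoin_range_algebraMap_X (σ : Type*) :
    IntermediateField.adjoin k (Set.range fun s : σ =>
      algebraMap (MvPolynomial σ k) (FractionRing (MvPolynomial σ k)) (X s)) = ⊤ := by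
  set F := IntermediateField.adjoin k (Set.range fun s : σ =>
      algebraMap (MvPolynomial σ k) (FractionRing (MvPolynomial σ k)) (X s))
  have hmem : ∀ p : MvPolynomial σ k, algebraMap _ (FractionRing (MvPolynomial σ k)) p ∈ F := by
    intro p
    induction p using MvPolynomial.induction_on with
    | C a => exact F.algebraMap_mem a
    | add p q hp hq => rw [map_add]; exact F.add_mem hp hq
    | mul_X p s hp =>
      rw [map_mul]
      exact F.mul_mem hp (IntermediateField.subset_adjoin k _ ⟨s, rfl⟩)
  refine eq_top_iff.2 fun e _ => ?_
  obtain ⟨p, q, -, rfl⟩ := IsFractionRing.div_surjective (A := MvPolynomial σ k) e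
  exact F.div_mem (hmem p) (hmem q)

theorem IsNonsingular.card_add_card_le [Fintype τ] [IsAlgClosed k] [Nonempty ι] [Nonempty κ]
    {c : τ → ι → κ → k} (hc : IsNonsingular c) :
    Fintype.card ι + Fintype.card κ ≤ Fintype.card τ + 1 := by
  obtain ⟨i₀⟩ := ‹Nonempty ι›
  obtain ⟨j₀⟩ := ‹Nonempty κ›
  let z : ι ⊕ κ → FractionRing (MvPolynomial (ι ⊕ κ) k) := fun s =>
    algebraMap (MvPolynomial (ι ⊕ κ) k) _ (X s)
  have hz : AlgebraicIndependent k z :=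
    (algebraicIndependent_X (ι ⊕ κ) k).map' (f := IsScalarTower.toAlgHom k _ _)
      (IsFractionRing.injective _ _)
  have halg := isAlgebraic_adjoin_of_bilinearPoly hc (x := z ∘ Sum.inl) (y := z ∘ Sum.inr)
    (by rw [Sum.elim_comp_inl_inr]; exact adjoin_range_algebraMap_X _) (hz.ne_zero (.inl i₀))
    (hz.ne_zero (.inr j₀))
  set S := insert ((z ∘ Sum.inl) i₀) (Set.range fun l =>
    aeval (Sum.elim (z ∘ Sum.inl) (z ∘ Sum.inr)) (bilinearPoly (c l)))
  have hle := hz.lift_cardinalMk_le_trdeg.trans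
    (Cardinal.lift_le.2 (Algebra.IsAlgebraic.trdeg_le_cardinalMk k S))
  have hS : S.Finite := (Set.finite_range _).insert _
  have hcard := Cardinal.toNat_le_toNat hle
    (Cardinal.lift_lt_aleph0.2 (Cardinal.lt_aleph0_iff_set_finite.2 hS))
  rw [Cardinal.toNat_lift, Cardinal.toNat_lift, Cardinal.mk_toNat_eq_card,
    Fintype.card_sum] at hcard
  calc _ ≤ S.ncard := hcard
    _ ≤ (Set.range fun l => _).ncard + 1 := Set.ncard_insert_le _ _
    _ ≤ Fintype.card τ + 1 := by
      rw [← Set.image_univ, ← Nat.card_eq_fintype_card, ← Set.ncard_univ]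
      exact Nat.add_le_add_right (Set.ncard_image_le) 1

end Hopf

/-! ### Binary forms -/

section BinaryForms

variable {R 𝕜 : Type*} [CommRing R] [Field 𝕜]

/-- The binary form `∑ⱼ aⱼ x₀ʲ x₁ᵈ⁻ʲ` with coefficient vector `a`. -/
def binaryForm (d : ℕ) (a : Fin (d + 1) → R) : MvPolynomial (Fin 2) R :=
  ∑ j, C (a j) * (X 0 ^ (j : ℕ) * X 1 ^ (d - j))

/-- The exponent of the monomial `x₀ʲ x₁ⁿ`. -/
def binaryExponent (j n : ℕ) : Fin 2 →₀ ℕ := Finsupp.single 0 j + Finsupp.single 1 n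

theorem X_pow_mul_X_pow_eq_monomial (j n : ℕ) :
    (X 0 ^ j * X 1 ^ n : MvPolynomial (Fin 2) R) = monomial (binaryExponent j n) 1 := by
  rw [X_pow_eq_monomial, X_pow_eq_monomial, monomial_mul, one_mul, binaryExponent]

theorem binaryExponent_inj {j n j' n' : ℕ} :
    binaryExponent j n = binaryExponent j' n' ↔ j = j' ∧ n = n' := by
  simp [binaryExponent, Finsupp.ext_iff, Fin.forall_fin_two]

theorem eq_binaryExponent (m : Fin 2 →₀ ℕ) : m = binaryExponent (m 0) (m 1) := by
  simp [binaryExponent, Finsupp.ext_iff, Fin.forall_fin_two]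

theorem coeff_binaryForm {d : ℕ} (a : Fin (d + 1) → R) (j : Fin (d + 1)) :
    coeff (binaryExponent j (d - j)) (binaryForm d a) = a j := by
  simp only [binaryForm, coeff_sum, X_pow_mul_X_pow_eq_monomial, coeff_C_mul, coeff_monomial,
    binaryExponent_inj]
  rw [Finset.sum_eq_single j (fun i _ hij => ?_) (by simp)]
  · simp
  · rw [if_neg fun h => hij (Fin.ext h.1), mul_zero]

theorem binaryForm_injective (d : ℕ) :
    Function.Injective (binaryForm d : (Fin (d + 1) → R) → MvPolynomial (Fin 2) R) :=
  fun a b h => funext fun j => by rw [← coeff_binaryForm a, h, coeff_binaryForm]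

@[simp] theorem binaryForm_zero (d : ℕ) : binaryForm d (0 : Fin (d + 1) → R) = 0 := by
  simp [binaryForm]

theorem binaryForm_eq_zero_iff {d : ℕ} {a : Fin (d + 1) → R} : binaryForm d a = 0 ↔ a = 0 := by
  rw [← binaryForm_zero d, (binaryForm_injective d).eq_iff]

theorem binaryForm_add {d : ℕ} (a b : Fin (d + 1) → R) :
    binaryForm d (a + b) = binaryForm d a + binaryForm d b := by
  simp [binaryForm, add_mul, Finset.sum_add_distrib]

theorem binaryForm_smul {d : ℕ} (t : R) (a : Fin (d + 1) → R) :
    binaryForm d (t • a) = C t * binaryForm d a := by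
  simp [binaryForm, Finset.mul_sum, mul_assoc]

theorem isHomogeneous_binaryForm {d : ℕ} (a : Fin (d + 1) → R) :
    (binaryForm d a).IsHomogeneous d := by
  refine IsHomogeneous.sum _ _ _ fun j _ => ?_
  rw [X_pow_mul_X_pow_eq_monomial]
  refine (isHomogeneous_monomial _ ?_).C_mul _
  simp only [binaryExponent, map_add, Finsupp.degree_single]
  lia

theorem exists_eq_binaryForm {d : ℕ} {f : MvPolynomial (Fin 2) R} (hf : f.IsHomogeneous d) :
    ∃ a, f = binaryForm d a := by
  refine ⟨fun j => coeff (binaryExponent j (d - j)) f, ?_⟩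
  ext m
  by_cases hm : m.degree = d
  · have hsum : m 0 + m 1 = d := by rw [← hm, Finsupp.degree_eq_sum, Fin.sum_univ_two]
    have hm' : m = binaryExponent (m 0) (d - m 0) := by
      conv_lhs => rw [eq_binaryExponent m]
      rw [binaryExponent_inj]
      lia
    rw [hm']
    exact (coeff_binaryForm (fun j : Fin (d + 1) => coeff (binaryExponent j (d - j)) f)
      ⟨m 0, by lia⟩).symm
  · rw [hf.coeff_eq_zero hm, (isHomogeneous_binaryForm _).coeff_eq_zero hm]

theorem eval_binaryForm {d : ℕ} (a : Fin (d + 1) → R) (x : Fin 2 → R) :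
    eval x (binaryForm d a) = ∑ j, a j * (x 0 ^ (j : ℕ) * x 1 ^ (d - j)) := by
  simp [binaryForm]

theorem exists_isHomogeneous_eq_mul_of_dvd {σ : Type*} {k m : ℕ} {f g : MvPolynomial σ R}
    (hf : f.IsHomogeneous (k + m)) (hg : g.IsHomogeneous k) (h : g ∣ f) :
    ∃ q, q.IsHomogeneous m ∧ f = g * q := by
  obtain ⟨q, rfl⟩ := h
  refine ⟨homogeneousComponent m q, homogeneousComponent_isHomogeneous _ _, ?_⟩
  have hcomp : ∀ i, homogeneousComponent (k + m) (g * homogeneousComponent i q) =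
      if i = m then g * homogeneousComponent m q else 0 := fun i => by
    rw [homogeneousComponent_of_mem (hg.mul (homogeneousComponent_isHomogeneous i q))]
    split_ifs <;> grind
  rw [← homogeneousComponent_eq_self hf]
  conv_lhs => rw [← sum_homogeneousComponent q, Finset.mul_sum, map_sum]
  simp only [hcomp, Finset.sum_ite_eq', Finset.mem_range]
  split_ifs with hm
  · rfl
  · rw [homogeneousComponent_eq_zero m q (by lia), mul_zero]

/-- The linear form `y ↦ x₁ y₀ - x₀ y₁`, whose zero on `ℙ¹` is `[x]`. -/
def linForm (x : Fin 2 → R) : MvPolynomial (Fin 2) R := C (x 1) * X 0 - C (x 0) * X 1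

theorem isHomogeneous_linForm (x : Fin 2 → R) : (linForm x).IsHomogeneous 1 :=
  (isHomogeneous_C_mul_X _ _).sub (isHomogeneous_C_mul_X _ _)

theorem eval_linForm (x y : Fin 2 → R) : eval y (linForm x) = x 1 * y 0 - x 0 * y 1 := by
  simp [linForm]

theorem eval_linForm_self (x : Fin 2 → R) : eval x (linForm x) = 0 := by
  rw [eval_linForm, mul_comm, sub_self]

theorem linForm_smul (t : R) (x : Fin 2 → R) : linForm (t • x) = C t * linForm x := by
  simp [linForm, mul_sub, mul_assoc]

theorem linForm_eq_zero_iff {x : Fin 2 → R} : linForm x = 0 ↔ x = 0 := by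
  refine ⟨fun h => ?_, fun h => by simp [h, linForm]⟩
  have h₀ := eval_linForm x ![1, 0]
  have h₁ := eval_linForm x ![0, 1]
  simp only [h, map_zero, Matrix.cons_val_zero, Matrix.cons_val_one, mul_one, mul_zero, sub_zero,
    zero_sub] at h₀ h₁
  ext i
  fin_cases i
  exacts [neg_eq_zero.1 h₁.symm, h₀.symm]

theorem exists_eq_linForm {f : MvPolynomial (Fin 2) R} (hf : f.IsHomogeneous 1) :
    ∃ x, f = linForm x := by
  obtain ⟨a, rfl⟩ := exists_eq_binaryForm hf
  refine ⟨![-a 0, a 1], ?_⟩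
  simp [binaryForm, linForm, Fin.sum_univ_two, add_comm]

theorem eval₂_mul_left_of_isHomogeneous {σ S : Type*} [CommRing S] {d : ℕ} {f : MvPolynomial σ R}
    (hf : f.IsHomogeneous d) (φ : R →+* S) (c : S) (u : σ → S) :
    eval₂ φ (fun i => c * u i) f = c ^ d * eval₂ φ u f := by
  simp only [eval₂_eq, Finset.mul_sum, mul_pow, Finset.prod_mul_distrib, Finset.prod_pow_eq_pow_sum]
  refine Finset.sum_congr rfl fun m hm => ?_
  have hdeg : ∑ i ∈ m.support, m i = d := by
    rw [← hf (mem_support_iff.1 hm)]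
    simp [Finsupp.weight_apply, Finsupp.sum]
  rw [hdeg]
  ring

/-- Modulo `x₁ X₀ - x₀ X₁` the vectors `xᵢ • X` and `Xᵢ • x` agree, hence so do their images
`xᵢᵈ f` and `f(x) Xᵢᵈ` under a form `f` of degree `d`. -/
theorem linForm_dvd_sub {d : ℕ} {f : MvPolynomial (Fin 2) R} (hf : f.IsHomogeneous d)
    (x : Fin 2 → R) (i : Fin 2) : linForm x ∣ C (x i) ^ d * f - C (eval x f) * X i ^ d := by
  rw [← Ideal.mem_span_singleton, ← Ideal.Quotient.eq]
  set π := Ideal.Quotient.mk (Ideal.span {linForm x})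
  have hswap : ∀ j, π (C (x i)) * π (X j) = π (X i) * π (C (x j)) := by
    have hlin : π (C (x 1)) * π (X 0) = π (C (x 0)) * π (X 1) := by
      rw [← map_mul, ← map_mul, Ideal.Quotient.eq]
      exact Ideal.mem_span_singleton_self _
    intro j
    fin_cases i <;> fin_cases j <;> simp only [Fin.zero_eta, Fin.mk_one, hlin, mul_comm]
    rw [mul_comm, ← hlin, mul_comm]
  have hX : π f = eval₂ (π.comp C) (fun j => π (X j)) f := by
    conv_lhs => rw [← eval₂_eta f, eval₂_comp_left]
    rfl
  have hx : π (C (eval x f)) = eval₂ (π.comp C) (fun j => π (C (x j))) f :=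
    eval₂_comp_left (π.comp C) (RingHom.id R) x f
  rw [map_mul, map_mul, map_pow, map_pow, hX, hx, ← eval₂_mul_left_of_isHomogeneous hf, mul_comm,
    ← eval₂_mul_left_of_isHomogeneous hf]
  exact congrArg (fun u => eval₂ _ u f) (funext hswap)

theorem linForm_dvd {d : ℕ} {f : MvPolynomial (Fin 2) 𝕜} (hf : f.IsHomogeneous d)
    {x : Fin 2 → 𝕜} (hx : x ≠ 0) (h : eval x f = 0) : linForm x ∣ f := by
  obtain ⟨i, hi⟩ := Function.ne_iff.1 hx
  have hdvd := linForm_dvd_sub hf x i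
  rw [h, C_0, zero_mul, sub_zero] at hdvd
  exact (((isUnit_iff_ne_zero.2 hi).map C).pow d).dvd_mul_left.1 hdvd

theorem exists_eq_linForm_mul {d : ℕ} {f : MvPolynomial (Fin 2) 𝕜} (hf : f.IsHomogeneous (d + 1))
    {x : Fin 2 → 𝕜} (hx : x ≠ 0) (h : eval x f = 0) :
    ∃ g, g.IsHomogeneous d ∧ f = linForm x * g := by
  rw [add_comm] at hf
  exact exists_isHomogeneous_eq_mul_of_dvd hf (isHomogeneous_linForm x) (linForm_dvd hf hx h)

theorem exists_eval_eq_zero_of_isHomogeneous [IsAlgClosed 𝕜] {d : ℕ} {f : MvPolynomial (Fin 2) 𝕜}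
    (hf : f.IsHomogeneous (d + 1)) : ∃ x : Fin 2 → 𝕜, x ≠ 0 ∧ eval x f = 0 := by
  classical
  obtain ⟨a, rfl⟩ := exists_eq_binaryForm hf
  by_cases ha : a (Fin.last _) = 0
  · refine ⟨![1, 0], fun h => by simpa using congrFun h 0, ?_⟩
    rw [eval_binaryForm, Fin.sum_univ_castSucc, ha, zero_mul, add_zero]
    refine Finset.sum_eq_zero fun j _ => ?_
    have hj : d + 1 - (j : ℕ) ≠ 0 := by lia
    simp [hj]
  · have hdeg : (Polynomial.ofFn (d + 2) a).degree ≠ 0 := by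
      intro h₀
      apply ha
      rw [show a (Fin.last _) = (Polynomial.ofFn (d + 2) a).coeff (d + 1) from
        (Polynomial.ofFn_coeff_eq_val_of_lt a (Nat.lt_succ_self _)).symm,
        Polynomial.eq_C_of_degree_eq_zero h₀, Polynomial.coeff_C_succ]
    obtain ⟨r, hr⟩ := IsAlgClosed.exists_root _ hdeg
    refine ⟨![r, 1], fun h => by simpa using congrFun h 1, ?_⟩
    rw [Polynomial.IsRoot, Polynomial.ofFn_eq_sum_monomial, Polynomial.eval_finsetSum] at hr
    simpa [eval_binaryForm] using hr

theorem exists_eq_linForm_mul_of_isHomogeneous [IsAlgClosed 𝕜] {d : ℕ}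
    {f : MvPolynomial (Fin 2) 𝕜} (hf : f.IsHomogeneous (d + 1)) :
    ∃ x : Fin 2 → 𝕜, x ≠ 0 ∧ ∃ g, g.IsHomogeneous d ∧ f = linForm x * g := by
  obtain ⟨x, hx, h⟩ := exists_eval_eq_zero_of_isHomogeneous hf
  exact ⟨x, hx, exists_eq_linForm_mul hf hx h⟩

theorem exists_smul_eq_of_eval_linForm_eq_zero {x y : Fin 2 → 𝕜} (hx : x ≠ 0)
    (h : eval y (linForm x) = 0) : ∃ t : 𝕜, y = t • x := by
  rw [eval_linForm, sub_eq_zero] at h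
  obtain ⟨i, hi⟩ := Function.ne_iff.1 hx
  refine ⟨y i / x i, funext fun j => ?_⟩
  rw [Pi.smul_apply, smul_eq_mul, div_mul_eq_mul_div, eq_div_iff hi]
  fin_cases i <;> fin_cases j <;> grind

end BinaryForms

/-! ### Contraction of functionals with forms -/

section Contraction

open Matrix

variable {R 𝕜 : Type*} [CommRing R] [Field 𝕜] {d k m : ℕ}

/-- The matrix of multiplication by the binary form with coefficient vector `g`, from forms of
degree `m` to forms of degree `d = k + m`. -/
def mulMatrix (d m : ℕ) (g : Fin (k + 1) → R) : Matrix (Fin (d + 1)) (Fin (m + 1)) R :=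
  .of fun l i => ∑ j : Fin (k + 1), if (l : ℕ) = i + j then g j else 0

theorem binaryForm_mulMatrix_mulVec (hkm : k + m = d) (g : Fin (k + 1) → R)
    (h : Fin (m + 1) → R) :
    binaryForm d (mulMatrix d m g *ᵥ h) = binaryForm k g * binaryForm m h := by
  have hterm : ∀ (i : Fin (m + 1)) (j : Fin (k + 1)),
      ∑ l : Fin (d + 1), C (if (l : ℕ) = i + j then g j else 0) * C (h i) *
        (X 0 ^ (l : ℕ) * X 1 ^ (d - l)) =
      C (g j) * (X 0 ^ (j : ℕ) * X 1 ^ (k - j)) *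
        (C (h i) * (X 0 ^ (i : ℕ) * X 1 ^ (m - i)) : MvPolynomial (Fin 2) R) := fun i j => by
    rw [Finset.sum_eq_single (⟨i + j, by lia⟩ : Fin (d + 1)) (fun l _ hl => ?_) (by simp)]
    · rw [if_pos rfl, show d - (i + j : ℕ) = (k - j) + (m - i) by lia, pow_add, pow_add]
      ring
    · rw [if_neg fun h => hl (Fin.ext h), C_0, zero_mul, zero_mul]
  rw [binaryForm, binaryForm, binaryForm, Finset.sum_mul_sum]
  simp only [mulVec, dotProduct, mulMatrix, of_apply, map_sum, map_mul, Finset.sum_mul]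
  rw [Finset.sum_comm, Finset.sum_comm (s := (Finset.univ : Finset (Fin (k + 1))))]
  refine Finset.sum_congr rfl fun i _ => ?_
  rw [Finset.sum_comm]
  exact Finset.sum_congr rfl fun j _ => hterm i j

/-- A vector `ν` is a functional on forms of degree `d`, pairing with coefficient vectors. Its
contraction with a form `g` is the functional `h ↦ ν (g h)` on forms of degree `m`. -/
def contract (m : ℕ) (g : Fin (k + 1) → R) : (Fin (d + 1) → R) →ₗ[R] (Fin (m + 1) → R) :=
  (mulMatrix d m g).vecMulLinear

theorem contract_eq_vecMul (g : Fin (k + 1) → R) (ν : Fin (d + 1) → R) :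
    contract m g ν = ν ᵥ* mulMatrix d m g := rfl

theorem contract_apply (hkm : k + m = d) (g : Fin (k + 1) → R) (ν : Fin (d + 1) → R)
    (i : Fin (m + 1)) : contract m g ν i = ∑ j : Fin (k + 1), g j * ν ⟨i + j, by lia⟩ := by
  simp only [contract_eq_vecMul, vecMul, dotProduct, mulMatrix, of_apply, Finset.mul_sum]
  rw [Finset.sum_comm]
  refine Finset.sum_congr rfl fun j _ => ?_
  rw [Finset.sum_eq_single (⟨i + j, by lia⟩ : Fin (d + 1)) (fun l _ hl => ?_) (by simp)]
  · rw [if_pos rfl, mul_comm]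
  · rw [if_neg fun h => hl (Fin.ext h), mul_zero]

theorem contract_smul_left (t : R) (g : Fin (k + 1) → R) (ν : Fin (d + 1) → R) :
    contract m (t • g) ν = t • contract m g ν := by
  ext i
  simp [contract_eq_vecMul, vecMul, dotProduct, mulMatrix, Finset.mul_sum, mul_left_comm]

theorem dotProduct_mulMatrix_mulVec (ν : Fin (d + 1) → R) (g : Fin (k + 1) → R)
    (h : Fin (m + 1) → R) : ν ⬝ᵥ (mulMatrix d m g *ᵥ h) = contract m g ν ⬝ᵥ h :=
  dotProduct_mulVec _ _ _

/-- The functionals on forms of degree `d` which vanish on the multiples of `g`. -/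
def annihilator (d m : ℕ) (g : Fin (k + 1) → 𝕜) : Submodule 𝕜 (Fin (d + 1) → 𝕜) :=
  LinearMap.ker (contract m g)

theorem mem_annihilator {g : Fin (k + 1) → 𝕜} {ν : Fin (d + 1) → 𝕜} :
    ν ∈ annihilator d m g ↔ contract m g ν = 0 := LinearMap.mem_ker

theorem mulMatrix_mulVec_injective (hkm : k + m = d) {g : Fin (k + 1) → 𝕜} (hg : g ≠ 0) :
    Function.Injective (mulMatrix d m g).mulVecLin := by
  refine (injective_iff_map_eq_zero _).2 fun h hh => ?_
  have hmul := binaryForm_mulMatrix_mulVec hkm g h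
  rw [← mulVecLin_apply, hh, binaryForm_zero, eq_comm, mul_eq_zero, binaryForm_eq_zero_iff,
    binaryForm_eq_zero_iff] at hmul
  exact hmul.resolve_left hg

theorem finrank_annihilator (hkm : k + m = d) {g : Fin (k + 1) → 𝕜} (hg : g ≠ 0) :
    Module.finrank 𝕜 (annihilator d m g) = k := by
  have hrank : (mulMatrix d m g)ᵀ.rank = m + 1 := by
    rw [rank_transpose, rank, LinearMap.finrank_range_of_inj (mulMatrix_mulVec_injective hkm hg),
      Module.finrank_fin_fun]
  have hker := LinearMap.finrank_range_add_finrank_ker (mulMatrix d m g)ᵀ.mulVecLin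
  rw [← rank, hrank, mulVecLin_transpose, Module.finrank_fin_fun] at hker
  have : Module.finrank 𝕜 (annihilator d m g) =
    Module.finrank 𝕜 (LinearMap.ker (mulMatrix d m g).vecMulLinear) := rfl
  lia

theorem contract_surjective (hkm : k + m = d) {g : Fin (k + 1) → 𝕜} (hg : g ≠ 0) :
    Function.Surjective (contract (d := d) m g) := by
  rw [← LinearMap.range_eq_top]
  refine Submodule.eq_top_of_finrank_eq ?_
  have hker := LinearMap.finrank_range_add_finrank_ker (contract (d := d) m g)
  have := finrank_annihilator hkm hg
  rw [Module.finrank_fin_fun] at hker ⊢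
  unfold annihilator at this
  lia

theorem mem_range_mulVecLin_iff {ι κ : Type*} [Fintype ι] [Fintype κ] (M : Matrix ι κ 𝕜)
    {f : ι → 𝕜} : f ∈ LinearMap.range M.mulVecLin ↔ ∀ ν, ν ᵥ* M = 0 → ν ⬝ᵥ f = 0 := by
  classical
  refine ⟨?_, fun h => ?_⟩
  · rintro ⟨a, rfl⟩ ν hν
    rw [mulVecLin_apply, dotProduct_mulVec, hν, zero_dotProduct]
  · by_contra hf
    obtain ⟨φ, hφ, hle⟩ := Submodule.exists_le_ker_of_notMem hf
    obtain ⟨ν, rfl⟩ := (dotProductEquiv 𝕜 ι).surjective φ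
    refine hφ (h ν (dotProduct_eq_zero_iff.1 fun a => ?_))
    rw [← dotProduct_mulVec]
    exact hle ⟨a, rfl⟩

theorem mem_range_mulMatrix_iff_dvd (hkm : k + m = d) {g : Fin (k + 1) → 𝕜}
    {f : Fin (d + 1) → 𝕜} :
    f ∈ LinearMap.range (mulMatrix d m g).mulVecLin ↔ binaryForm k g ∣ binaryForm d f := by
  constructor
  · rintro ⟨a, rfl⟩
    exact ⟨binaryForm m a, binaryForm_mulMatrix_mulVec hkm g a⟩
  · intro h
    have hf : (binaryForm d f).IsHomogeneous (k + m) := by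
      rw [hkm]
      exact isHomogeneous_binaryForm f
    obtain ⟨q, hq, hfq⟩ := exists_isHomogeneous_eq_mul_of_dvd hf (isHomogeneous_binaryForm g) h
    obtain ⟨a, rfl⟩ := exists_eq_binaryForm hq
    exact ⟨a, binaryForm_injective d (by
      rw [mulVecLin_apply, binaryForm_mulMatrix_mulVec hkm, hfq])⟩

theorem binaryForm_dvd_iff (hkm : k + m = d) {g : Fin (k + 1) → 𝕜} {f : Fin (d + 1) → 𝕜} :
    binaryForm k g ∣ binaryForm d f ↔ ∀ ν ∈ annihilator d m g, ν ⬝ᵥ f = 0 :=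
  (mem_range_mulMatrix_iff_dvd hkm).symm.trans (mem_range_mulVecLin_iff _)

theorem mem_annihilator_iff (hkm : k + m = d) {g : Fin (k + 1) → 𝕜} {ν : Fin (d + 1) → 𝕜} :
    ν ∈ annihilator d m g ↔ ∀ f, binaryForm k g ∣ binaryForm d f → ν ⬝ᵥ f = 0 := by
  refine ⟨fun h f hf => (binaryForm_dvd_iff hkm).1 hf ν h, fun h => mem_annihilator.2 ?_⟩
  refine dotProduct_eq_zero_iff.1 fun a => ?_
  rw [← dotProduct_mulMatrix_mulVec]
  exact h _ ⟨_, binaryForm_mulMatrix_mulVec hkm g a⟩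

theorem annihilator_le_of_dvd {k' m' : ℕ} (hkm : k + m = d) (hkm' : k' + m' = d)
    {g : Fin (k + 1) → 𝕜} {g' : Fin (k' + 1) → 𝕜} (h : binaryForm k g ∣ binaryForm k' g') :
    annihilator d m g ≤ annihilator d m' g' := fun ν hν =>
  (mem_annihilator_iff hkm').2 fun _ hf => (binaryForm_dvd_iff hkm).1 (h.trans hf) ν hν

end Contraction

/-! ### Evaluation functionals and the embedding condition -/

section Evaluation

open Matrix

variable {𝕜 : Type*} [Field 𝕜] {d k m : ℕ}

/-- Evaluation at `x`, as a functional on forms of degree `d`. -/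
def evalVec (d : ℕ) (x : Fin 2 → 𝕜) : Fin (d + 1) → 𝕜 := fun l => x 0 ^ (l : ℕ) * x 1 ^ (d - l)

/-- Evaluation at `x` of the `j`-th partial derivative, as a functional on forms of degree `d`. -/
def derivVec (d : ℕ) (j : Fin 2) (x : Fin 2 → 𝕜) : Fin (d + 1) → 𝕜 := fun l =>
  eval x (pderiv j (X 0 ^ (l : ℕ) * X 1 ^ (d - l)))

theorem dotProduct_evalVec (f : Fin (d + 1) → 𝕜) (x : Fin 2 → 𝕜) :
    f ⬝ᵥ evalVec d x = eval x (binaryForm d f) := by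
  rw [eval_binaryForm]; rfl

theorem dotProduct_derivVec (f : Fin (d + 1) → 𝕜) (j : Fin 2) (x : Fin 2 → 𝕜) :
    f ⬝ᵥ derivVec d j x = eval x (pderiv j (binaryForm d f)) := by
  simp only [dotProduct, binaryForm, map_sum, pderiv_C_mul, derivVec, map_mul, eval_C]

theorem evalVec_mem_annihilator (hkm : k + m = d) {g : Fin (k + 1) → 𝕜} {x : Fin 2 → 𝕜}
    (h : eval x (binaryForm k g) = 0) : evalVec d x ∈ annihilator d m g := by
  rw [mem_annihilator_iff hkm]
  rintro f ⟨q, hq⟩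
  rw [dotProduct_comm, dotProduct_evalVec, hq, map_mul, h, zero_mul]

theorem derivVec_mem_annihilator (hkm : k + m = d) {g : Fin (k + 1) → 𝕜} {x : Fin 2 → 𝕜}
    (h : linForm x ^ 2 ∣ binaryForm k g) (j : Fin 2) : derivVec d j x ∈ annihilator d m g := by
  rw [mem_annihilator_iff hkm]
  intro f hf
  obtain ⟨q, hq⟩ := h.trans hf
  rw [dotProduct_comm, dotProduct_derivVec, hq, pow_two, pderiv_mul, pderiv_mul]
  simp [eval_linForm_self]

theorem disjoint_ker_annihilator {V : Type*} [AddCommGroup V] [Module 𝕜 V]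
    {T : (Fin (d + 1) → 𝕜) →ₗ[𝕜] V} (hkm : k + m = d) {g : Fin (k + 1) → 𝕜} (hg : g ≠ 0)
    {ν : Fin k → Fin (d + 1) → 𝕜} (hν : ∀ j, ν j ∈ annihilator d m g)
    (hT : LinearIndependent 𝕜 fun j => T (ν j)) :
    Disjoint (LinearMap.ker T) (annihilator d m g) := by
  have hindep : LinearIndependent 𝕜 ν := LinearIndependent.of_comp T hT
  have hspan : Submodule.span 𝕜 (Set.range ν) = annihilator d m g := by
    refine Submodule.eq_of_le_of_finrank_le (Submodule.span_le.2 (Set.range_subset_iff.2 hν)) ?_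
    rw [finrank_annihilator hkm hg, finrank_span_eq_card hindep, Fintype.card_fin]
  rw [Submodule.disjoint_def, ← hspan]
  intro μ hμ hμν
  obtain ⟨c, rfl⟩ := (Submodule.mem_span_range_iff_exists_fun 𝕜).1 hμν
  have hc := Fintype.linearIndependent_iff.1 hT c (by simpa using hμ)
  simp [hc]

/-- A space of functionals on forms of degree `d` in which only zero vanishes on the multiples of
some quadratic form. For `𝕜` algebraically closed this says that the linear system of the forms
annihilated by `K` separates points and tangent vectors. -/
def IsSeparating (K : Submodule 𝕜 (Fin (d + 1) → 𝕜)) : Prop :=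
  ∀ ⦃m : ℕ⦄, 2 + m = d → ∀ q : Fin 3 → 𝕜, q ≠ 0 → Disjoint K (annihilator d m q)

theorem exists_eq_linForm_mul_linForm [IsAlgClosed 𝕜] {q : Fin 3 → 𝕜} (hq : q ≠ 0) :
    ∃ x y : Fin 2 → 𝕜, x ≠ 0 ∧ y ≠ 0 ∧ binaryForm 2 q = linForm x * linForm y := by
  obtain ⟨x, hx, g, hg, hqg⟩ := exists_eq_linForm_mul_of_isHomogeneous (isHomogeneous_binaryForm q)
  obtain ⟨y, rfl⟩ := exists_eq_linForm hg
  refine ⟨x, y, hx, ?_, hqg⟩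
  rintro rfl
  exact hq (by rw [← binaryForm_eq_zero_iff, hqg, linForm_eq_zero_iff.2 rfl, mul_zero])

end Evaluation

namespace SmoothRationalCurve

open Matrix

variable {n d k m : ℕ} (C : SmoothRationalCurve n d)

/-- The matrix whose rows are the coefficient vectors of the coordinate forms. -/
def coeffMatrix : Matrix (Fin (n + 1)) (Fin (d + 1)) ℂ :=
  .of fun i => (exists_eq_binaryForm (C.homogeneous i)).choose

theorem form_eq (i : Fin (n + 1)) : C.form i = binaryForm d (C.coeffMatrix i) :=
  (exists_eq_binaryForm (C.homogeneous i)).choose_spec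

/-- The transpose of the restriction of linear forms to the curve. It maps the evaluation at a
point of `ℙ¹` to the corresponding point of the curve. -/
def spanMap : (Fin (d + 1) → ℂ) →ₗ[ℂ] (Fin (n + 1) → ℂ) := C.coeffMatrix.mulVecLin

theorem spanMap_evalVec (x : Fin 2 → ℂ) : C.spanMap (evalVec d x) = evalForms C.form x :=
  funext fun i => (dotProduct_evalVec _ _).trans (by rw [← form_eq]; rfl)

theorem spanMap_derivVec (j : Fin 2) (x : Fin 2 → ℂ) :
    C.spanMap (derivVec d j x) = evalForms (fun i => pderiv j (C.form i)) x :=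
  funext fun i => (dotProduct_derivVec _ _ _).trans (by rw [← form_eq]; rfl)

/-- The coefficient vector of the restriction of a linear form. -/
def restrictCoeffs (ℓ : Module.Dual ℂ (Fin (n + 1) → ℂ)) : Fin (d + 1) → ℂ :=
  (dotProductEquiv ℂ _).symm (ℓ ∘ₗ C.spanMap)

theorem dotProduct_restrictCoeffs (ℓ : Module.Dual ℂ (Fin (n + 1) → ℂ)) (ν : Fin (d + 1) → ℂ) :
    ν ⬝ᵥ C.restrictCoeffs ℓ = ℓ (C.spanMap ν) := by
  rw [dotProduct_comm]
  exact LinearMap.congr_fun ((dotProductEquiv ℂ _).apply_symm_apply (ℓ ∘ₗ C.spanMap)) ν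

theorem restrict_eq (ℓ : Module.Dual ℂ (Fin (n + 1) → ℂ)) :
    C.restrict ℓ = binaryForm d (C.restrictCoeffs ℓ) := by
  have hcoeff : ∀ l, C.restrictCoeffs ℓ l = ∑ i, ℓ (Pi.single i 1) * C.coeffMatrix i l := by
    intro l
    change ℓ (C.coeffMatrix *ᵥ Pi.single l 1) = _
    obtain ⟨w, rfl⟩ := (dotProductEquiv ℂ _).surjective ℓ
    simp only [mulVec_single_one, dotProductEquiv_apply_apply, dotProduct_single_one]
    rfl
  simp only [restrict, form_eq, binaryForm, hcoeff, map_sum, Finset.mul_sum, Finset.sum_mul]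
  rw [Finset.sum_comm]
  simp [mul_assoc]

theorem forall_dvd_restrict_iff (hkm : k + m = d) (L : LineIn n) (g : Fin (k + 1) → ℂ) :
    (∀ ℓ ∈ L.1.dualAnnihilator, binaryForm k g ∣ C.restrict ℓ) ↔
      (annihilator d m g).map C.spanMap ≤ L.1 := by
  simp only [restrict_eq, binaryForm_dvd_iff hkm, dotProduct_restrictCoeffs]
  constructor
  · rintro h _ ⟨ν, hν, rfl⟩
    rw [← Subspace.dualAnnihilator_dualCoannihilator_eq (W := L.1),
      Submodule.mem_dualCoannihilator]
    exact fun ℓ hℓ => h ℓ hℓ ν hν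
  · exact fun h ℓ hℓ ν hν => (Submodule.mem_dualAnnihilator ℓ).1 hℓ _ (h ⟨ν, hν, rfl⟩)

theorem isSecant_iff (hkm : k + m = d) (L : LineIn n) :
    C.IsSecant k L ↔
      ∃ g : Fin (k + 1) → ℂ, g ≠ 0 ∧ (annihilator d m g).map C.spanMap ≤ L.1 := by
  constructor
  · rintro ⟨g, hg₀, hg, h⟩
    obtain ⟨a, rfl⟩ := exists_eq_binaryForm hg
    exact ⟨a, mt binaryForm_eq_zero_iff.2 hg₀, (C.forall_dvd_restrict_iff hkm L a).1 h⟩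
  · rintro ⟨a, ha, h⟩
    exact ⟨binaryForm k a, mt binaryForm_eq_zero_iff.1 ha, isHomogeneous_binaryForm a,
      (C.forall_dvd_restrict_iff hkm L a).2 h⟩

theorem onPoints_mk {x : Fin 2 → ℂ} (hx : x ≠ 0) :
    C.toProjLineMorphism.onPoints (Projectivization.mk ℂ x hx) =
      Projectivization.mk ℂ (evalForms C.form x) (C.base_point_free x hx) := rfl

theorem linearIndependent_evalForms {x y : Fin 2 → ℂ} (hx : x ≠ 0) (hy : y ≠ 0)
    (h : ¬ ∃ t : ℂ, y = t • x) :
    LinearIndependent ℂ ![evalForms C.form x, evalForms C.form y] := by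
  rw [LinearIndependent.pair_iff' (C.base_point_free x hx)]
  intro t ht
  have heq : Projectivization.mk ℂ y hy = Projectivization.mk ℂ x hx := by
    apply C.injective
    rw [onPoints_mk, onPoints_mk, Projectivization.mk_eq_mk_iff']
    exact ⟨t, ht⟩
  obtain ⟨s, hs⟩ := (Projectivization.mk_eq_mk_iff' ℂ _ _ _ _).1 heq
  exact h ⟨s, hs.symm⟩

theorem isSeparating_ker_spanMap : IsSeparating (LinearMap.ker C.spanMap) := by
  intro m hm q hq
  obtain ⟨x, y, hx, hy, hxy⟩ := exists_eq_linForm_mul_linForm hq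
  by_cases h : ∃ t : ℂ, y = t • x
  · obtain ⟨t, rfl⟩ := h
    have hsq : linForm x ^ 2 ∣ binaryForm 2 q := ⟨MvPolynomial.C t, by
      rw [hxy, linForm_smul]; ring⟩
    refine disjoint_ker_annihilator hm hq (fun j => derivVec_mem_annihilator hm hsq j) ?_
    simpa only [spanMap_derivVec] using C.immersion x hx
  · refine disjoint_ker_annihilator (ν := ![evalVec d x, evalVec d y]) hm hq ?_ ?_
    · intro j
      fin_cases j
      · exact evalVec_mem_annihilator hm (by rw [hxy, map_mul, eval_linForm_self, zero_mul])
      · exact evalVec_mem_annihilator hm (by rw [hxy, map_mul, eval_linForm_self, mul_zero])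
    · rw [show (fun j => C.spanMap (![evalVec d x, evalVec d y] j)) =
          ![evalForms C.form x, evalForms C.form y] by
        funext j
        fin_cases j <;> simp [spanMap_evalVec]]
      exact C.linearIndependent_evalForms hx hy h

end SmoothRationalCurve

/-! ### Trisecant lines -/

section Hankel

open Matrix

variable {R 𝕜 : Type*} [CommRing R] [Field 𝕜] {d k m : ℕ}

/-- The Hankel (catalecticant) matrix of a functional `ν` on forms of degree `d = k + m`. It is the
matrix of the contraction of `ν` with forms of degree `k`. -/
def hankel (hkm : k + m = d) (ν : Fin (d + 1) → R) : Matrix (Fin (m + 1)) (Fin (k + 1)) R :=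
  .of fun i j => ν ⟨i + j, by lia⟩

theorem hankel_mulVec (hkm : k + m = d) (ν : Fin (d + 1) → R) (g : Fin (k + 1) → R) :
    hankel hkm ν *ᵥ g = contract m g ν := by
  ext i
  simp only [contract_apply hkm, mulVec, dotProduct, hankel, of_apply, mul_comm]

omit [CommRing R] in
theorem transpose_hankel (hkm : k + m = d) (ν : Fin (d + 1) → R) :
    (hankel hkm ν)ᵀ = hankel ((add_comm m k).trans hkm) ν := by
  ext i j
  simp only [hankel, transpose_apply, of_apply, add_comm]

theorem hankel_mulVec_eq_zero_iff (hkm : k + m = d) {ν : Fin (d + 1) → 𝕜} {g : Fin (k + 1) → 𝕜} :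
    hankel hkm ν *ᵥ g = 0 ↔ ν ∈ annihilator d m g := by
  rw [hankel_mulVec, mem_annihilator]

end Hankel

theorem finrank_map_add_finrank_ker_inf {𝕜 V W : Type*} [Field 𝕜] [AddCommGroup V] [Module 𝕜 V]
    [AddCommGroup W] [Module 𝕜 W] [FiniteDimensional 𝕜 V] (T : V →ₗ[𝕜] W) (p : Submodule 𝕜 V) :
    Module.finrank 𝕜 (p.map T) + Module.finrank 𝕜 (LinearMap.ker T ⊓ p : Submodule 𝕜 V) =
      Module.finrank 𝕜 p := by
  have h := LinearMap.finrank_range_add_finrank_ker (T.domRestrict p)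
  rwa [LinearMap.range_domRestrict, LinearMap.ker_domRestrict, ← Submodule.finrank_map_subtype_eq,
    Submodule.map_comap_subtype, inf_comm] at h

namespace IsSeparating

open Matrix

variable {𝕜 : Type*} [Field 𝕜]

theorem finrank_inf_annihilator_le [IsAlgClosed 𝕜] {d k m : ℕ} {K : Submodule 𝕜 (Fin (d + 1) → 𝕜)}
    (hK : IsSeparating K) (hkm : k + 2 + m = d) {g : Fin (k + 2 + 1) → 𝕜} (hg : g ≠ 0) :
    Module.finrank 𝕜 (K ⊓ annihilator d m g : Submodule 𝕜 (Fin (d + 1) → 𝕜)) ≤ k := by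
  obtain ⟨x, hx, g₁, hg₁, hgx⟩ :=
    exists_eq_linForm_mul_of_isHomogeneous (isHomogeneous_binaryForm g)
  obtain ⟨y, hy, g₂, -, hgy⟩ := exists_eq_linForm_mul_of_isHomogeneous hg₁
  obtain ⟨q, hq⟩ := exists_eq_binaryForm ((isHomogeneous_linForm x).mul (isHomogeneous_linForm y))
  have hq0 : q ≠ 0 := by
    rw [Ne, ← binaryForm_eq_zero_iff, ← hq, mul_eq_zero, linForm_eq_zero_iff, linForm_eq_zero_iff]
    exact not_or_intro hx hy
  have hle : annihilator d (k + m) q ≤ annihilator d m g :=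
    annihilator_le_of_dvd (by lia) hkm ⟨g₂, by rw [← hq, hgx, hgy, mul_assoc]⟩
  have hsup := Submodule.finrank_mono (sup_le (inf_le_right (a := K)) hle)
  have hadd := Submodule.finrank_sup_add_finrank_inf_eq (K ⊓ annihilator d m g)
    (annihilator d (k + m) q)
  rw [(((hK (by lia) q hq0).mono_left inf_le_left).eq_bot), finrank_bot,
    finrank_annihilator (by lia) hq0] at hadd
  rw [finrank_annihilator hkm hg] at hsup
  lia

variable {K : Submodule 𝕜 (Fin (5 + 1) → 𝕜)} (hK : IsSeparating K) {ν : Fin (5 + 1) → 𝕜}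
  (hν : ν ∈ K) (hν₀ : ν ≠ 0)

include hK hν hν₀

theorem rank_hankel : (hankel (rfl : 3 + 2 = 5) ν).rank = 3 := by
  rw [← rank_transpose, transpose_hankel, rank, LinearMap.finrank_range_of_inj,
    Module.finrank_fin_fun]
  refine (injective_iff_map_eq_zero _).2 fun q hq => ?_
  by_contra hq0
  exact hν₀ ((hK rfl q hq0).eq_bot.le ⟨hν, (hankel_mulVec_eq_zero_iff _).1 hq⟩)

theorem hankel_mulVec_surjective :
    Function.Surjective (hankel (rfl : 3 + 2 = 5) ν).mulVec := by
  change Function.Surjective (hankel (rfl : 3 + 2 = 5) ν).mulVecLin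
  rw [← LinearMap.range_eq_top]
  refine Submodule.eq_top_of_finrank_eq ?_
  rw [← rank, hK.rank_hankel hν hν₀, Module.finrank_fin_fun]

theorem finrank_ker_hankel :
    Module.finrank 𝕜 (LinearMap.ker (hankel (rfl : 3 + 2 = 5) ν).mulVecLin) = 1 := by
  have h := LinearMap.finrank_range_add_finrank_ker (hankel (rfl : 3 + 2 = 5) ν).mulVecLin
  rw [← rank, hK.rank_hankel hν hν₀, Module.finrank_fin_fun] at h
  lia

theorem exists_cubic : ∃ g : Fin (3 + 1) → 𝕜, g ≠ 0 ∧ ν ∈ annihilator 5 2 g := by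
  obtain ⟨⟨g, hg⟩, hg0, -⟩ := finrank_eq_one_iff'.1 (hK.finrank_ker_hankel hν hν₀)
  exact ⟨g, fun h => hg0 (Subtype.ext h), (hankel_mulVec_eq_zero_iff rfl).1 hg⟩

theorem eq_smul_cubic {g g' : Fin (3 + 1) → 𝕜} (hg : g ≠ 0) (h : ν ∈ annihilator 5 2 g)
    (h' : ν ∈ annihilator 5 2 g') : ∃ t : 𝕜, g' = t • g := by
  obtain ⟨t, ht⟩ := (finrank_eq_one_iff_of_nonzero'
    (⟨g, (hankel_mulVec_eq_zero_iff rfl).2 h⟩ : LinearMap.ker (hankel rfl ν).mulVecLin)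
    fun h => hg (congrArg Subtype.val h)).1 (hK.finrank_ker_hankel hν hν₀)
    ⟨g', (hankel_mulVec_eq_zero_iff rfl).2 h'⟩
  exact ⟨t, (congrArg Subtype.val ht).symm⟩

theorem annihilator_eq_of_mem {g g' : Fin (3 + 1) → 𝕜} (hg : g ≠ 0) (hg' : g' ≠ 0)
    (h : ν ∈ annihilator 5 2 g) (h' : ν ∈ annihilator 5 2 g') :
    annihilator 5 2 g' = annihilator 5 2 g := by
  obtain ⟨t, rfl⟩ := hK.eq_smul_cubic hν hν₀ hg h h'
  have ht : t ≠ 0 := fun h => hg' (by rw [h, zero_smul])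
  ext μ
  rw [mem_annihilator, mem_annihilator, contract_smul_left, smul_eq_zero_iff_right ht]

end IsSeparating

namespace SmoothRationalCurve

variable {n d k m : ℕ} (C : SmoothRationalCurve n d)

theorem le_finrank_inf_annihilator (hkm : k + m = d) {g : Fin (k + 1) → ℂ} (hg : g ≠ 0)
    {L : LineIn n} (h : (annihilator d m g).map C.spanMap ≤ L.1) :
    k ≤ Module.finrank ℂ (LinearMap.ker C.spanMap ⊓ annihilator d m g :
      Submodule ℂ (Fin (d + 1) → ℂ)) + 2 := by
  have hadd := finrank_map_add_finrank_ker_inf C.spanMap (annihilator d m g)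
  have hle := Submodule.finrank_mono h
  rw [L.2] at hle
  rw [finrank_annihilator hkm hg] at hadd
  lia

theorem finrank_map_annihilator (hm : 3 + m = d) {ν : Fin (d + 1) → ℂ} (hν : C.spanMap ν = 0)
    (hν₀ : ν ≠ 0) {g : Fin (3 + 1) → ℂ} (hg : g ≠ 0) (h : ν ∈ annihilator d m g) :
    Module.finrank ℂ ((annihilator d m g).map C.spanMap) = 2 := by
  have hadd := finrank_map_add_finrank_ker_inf C.spanMap (annihilator d m g)
  have hle := C.isSeparating_ker_spanMap.finrank_inf_annihilator_le (k := 1) hm hg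
  have hpos : 0 < Module.finrank ℂ (LinearMap.ker C.spanMap ⊓ annihilator d m g :
      Submodule ℂ (Fin (d + 1) → ℂ)) :=
    Module.finrank_pos_iff_exists_ne_zero.2 ⟨⟨ν, hν, h⟩, fun h => hν₀ (congrArg Subtype.val h)⟩
  rw [finrank_annihilator hm hg] at hadd
  lia

theorem isSecant_three_iff (hm : 3 + m = d) (L : LineIn n) :
    C.IsSecant 3 L ↔ ∃ ν : Fin (d + 1) → ℂ, ν ≠ 0 ∧ C.spanMap ν = 0 ∧
      ∃ g : Fin (3 + 1) → ℂ, g ≠ 0 ∧ ν ∈ annihilator d m g ∧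
        L.1 = (annihilator d m g).map C.spanMap := by
  rw [C.isSecant_iff hm]
  constructor
  · rintro ⟨g, hg, hle⟩
    have hpos : 0 < Module.finrank ℂ (LinearMap.ker C.spanMap ⊓ annihilator d m g :
        Submodule ℂ (Fin (d + 1) → ℂ)) := by
      have := C.le_finrank_inf_annihilator hm hg hle
      lia
    obtain ⟨⟨ν, hν, hνg⟩, hν₀⟩ := Module.finrank_pos_iff_exists_ne_zero.1 hpos
    have hν₀' : ν ≠ 0 := fun h => hν₀ (Subtype.ext h)
    refine ⟨ν, hν₀', hν, g, hg, hνg, (Submodule.eq_of_le_of_finrank_le hle ?_).symm⟩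
    rw [L.2, C.finrank_map_annihilator hm hν hν₀' hg hνg]
  · rintro ⟨ν, -, -, g, hg, -, h⟩
    exact ⟨g, hg, h.ge⟩

theorem exists_isSecant_three (C : SmoothRationalCurve n 5) {ν : Fin (5 + 1) → ℂ} (hν₀ : ν ≠ 0)
    (hν : C.spanMap ν = 0) :
    ∃ L : LineIn n, C.IsSecant 3 L ∧ ∃ g : Fin (3 + 1) → ℂ, g ≠ 0 ∧
      ν ∈ annihilator 5 2 g ∧ L.1 = (annihilator 5 2 g).map C.spanMap := by
  obtain ⟨g, hg, h⟩ := C.isSeparating_ker_spanMap.exists_cubic hν hν₀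
  exact ⟨⟨_, C.finrank_map_annihilator rfl hν hν₀ hg h⟩,
    (C.isSecant_three_iff rfl _).2 ⟨ν, hν₀, hν, g, hg, h, rfl⟩, g, hg, h, rfl⟩

theorem spanMap_surjective_of_nondegenerate (h : C.Nondegenerate) :
    Function.Surjective C.spanMap := by
  rw [← LinearMap.range_eq_top]
  by_contra hne
  obtain ⟨ℓ, hℓ, hle⟩ := Submodule.exists_le_ker_of_lt_top _ (lt_top_iff_ne_top.2 hne)
  obtain ⟨P, ⟨x, rfl⟩, hP⟩ := h ℓ hℓ
  induction x using Projectivization.ind with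
  | h x hx =>
    refine hP ?_
    rw [onPoints_mk]
    obtain ⟨a, ha⟩ := Projectivization.exists_smul_eq_mk_rep ℂ _ (C.base_point_free x hx)
    rw [← ha, ← spanMap_evalVec, Units.smul_def, map_smul,
      LinearMap.mem_ker.1 (hle ⟨evalVec d x, rfl⟩), smul_zero]

theorem finrank_ker_spanMap_of_surjective (h : Function.Surjective C.spanMap) :
    Module.finrank ℂ (LinearMap.ker C.spanMap) + n = d := by
  have hadd := LinearMap.finrank_range_add_finrank_ker C.spanMap
  rw [LinearMap.range_eq_top.2 h, finrank_top, Module.finrank_fin_fun,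
    Module.finrank_fin_fun] at hadd
  lia

theorem existsUnique_trisecant (C : SmoothRationalCurve 4 5) (hC : C.Nondegenerate) :
    ∃ L : LineIn 4, C.IsSecant 3 L ∧ (∀ M : LineIn 4, C.IsSecant 3 M → M = L) ∧
      ¬ C.IsSecant 4 L := by
  have hker : Module.finrank ℂ (LinearMap.ker C.spanMap) = 1 := by
    have := C.finrank_ker_spanMap_of_surjective (C.spanMap_surjective_of_nondegenerate hC)
    lia
  obtain ⟨⟨ν, hν⟩, hν₀, hspan⟩ := finrank_eq_one_iff'.1 hker
  have hν₀' : ν ≠ 0 := fun h => hν₀ (Subtype.ext h)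
  obtain ⟨L, hL, g, hg, hνg, hLg⟩ := C.exists_isSecant_three hν₀' hν
  refine ⟨L, hL, fun M hM => ?_, fun h4 => ?_⟩
  · obtain ⟨μ, hμ₀, hμ, g', hg', hμg', hMg'⟩ :=
      (C.isSecant_three_iff (rfl : 3 + 2 = 5) M).1 hM
    obtain ⟨t, ht⟩ := hspan ⟨μ, hμ⟩
    obtain rfl : t • ν = μ := congrArg Subtype.val ht
    have hμg : t • ν ∈ annihilator 5 2 g := Submodule.smul_mem _ t hνg
    apply Subtype.ext
    rw [hMg', hLg, C.isSeparating_ker_spanMap.annihilator_eq_of_mem hμ hμ₀ hg hg' hμg hμg']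
  · obtain ⟨h, hh, hle⟩ := (C.isSecant_iff (rfl : 4 + 1 = 5) L).1 h4
    have h2 := C.le_finrank_inf_annihilator rfl hh hle
    have h1 := Submodule.finrank_mono (inf_le_left :
      LinearMap.ker C.spanMap ⊓ annihilator 5 1 h ≤ _)
    lia

end SmoothRationalCurve

namespace IsSeparating

variable {𝕜 : Type*} [Field 𝕜] {d m : ℕ} {K : Submodule 𝕜 (Fin (d + 1) → 𝕜)}

theorem isNonsingular_hankel (hK : IsSeparating K) (hm : 2 + m = d) {ι : Type*} [Fintype ι]
    {b : ι → Fin (d + 1) → 𝕜} (hb : LinearIndependent 𝕜 b) (hbK : ∀ i, b i ∈ K) :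
    IsNonsingular fun l i j => hankel hm (b i) l j := by
  intro x y hxy
  have hmem : ∑ i, x i • b i ∈ K := K.sum_mem fun i _ => K.smul_mem _ (hbK i)
  have hann : ∑ i, x i • b i ∈ annihilator d m y := by
    refine (hankel_mulVec_eq_zero_iff hm).1 (funext fun l => (Eq.trans ?_ (hxy l)))
    simp only [Matrix.mulVec, dotProduct, hankel, Matrix.of_apply, Finset.sum_apply,
      Pi.smul_apply, smul_eq_mul, Finset.sum_mul]
    rw [Finset.sum_comm]
    exact Finset.sum_congr rfl fun i _ => Finset.sum_congr rfl fun j _ => by ring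
  by_contra! hne
  have hx := (hK hm y hne.2).le_bot ⟨hmem, hann⟩
  exact hne.1 (funext (Fintype.linearIndependent_iff.1 hb x hx))

theorem finrank_le [IsAlgClosed 𝕜] (hK : IsSeparating K) (hm : 2 + m = d) :
    Module.finrank 𝕜 K ≤ m - 1 := by
  rcases Nat.eq_zero_or_pos (Module.finrank 𝕜 K) with h0 | hpos
  · rw [h0]
    exact Nat.zero_le _
  have : Nonempty (Fin (Module.finrank 𝕜 K)) := ⟨⟨0, hpos⟩⟩
  have hcard := (hK.isNonsingular_hankel hm ((Module.finBasis 𝕜 K).linearIndependent.map'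
    K.subtype K.ker_subtype) fun i => (Module.finBasis 𝕜 K i).2).card_add_card_le
  simp only [Fintype.card_fin] at hcard
  lia

end IsSeparating

namespace SmoothRationalCurve

variable (C : SmoothRationalCurve 3 5)

theorem finrank_ker_spanMap : Module.finrank ℂ (LinearMap.ker C.spanMap) = 2 := by
  have hle := C.isSeparating_ker_spanMap.finrank_le (rfl : 2 + 3 = 5)
  have hadd := LinearMap.finrank_range_add_finrank_ker C.spanMap
  have hrange := Submodule.finrank_le (LinearMap.range C.spanMap)
  rw [Module.finrank_fin_fun] at hadd hrange
  lia

theorem spanMap_surjective : Function.Surjective C.spanMap := by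
  rw [← LinearMap.range_eq_top]
  refine Submodule.eq_top_of_finrank_eq ?_
  have hadd := LinearMap.finrank_range_add_finrank_ker C.spanMap
  rw [finrank_ker_spanMap, Module.finrank_fin_fun] at hadd
  rw [Module.finrank_fin_fun]
  lia

end SmoothRationalCurve

/-! ### Polynomial families of trisecant lines -/

section PolynomialFamilies

open Matrix Polynomial Filter

variable {R 𝕜 ι κ : Type*} [CommRing R] [Field 𝕜]

/-- The value at `t` of a polynomial family of vectors. -/
def evalAt (t : R) (a : ι → R[X]) : ι → R := fun i => (a i).eval t

theorem evalAt_mulVec [Fintype κ] (t : R) (A : Matrix ι κ R[X]) (a : κ → R[X]) :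
    evalAt t (A *ᵥ a) = A.map (Polynomial.eval t) *ᵥ evalAt t a :=
  funext fun i => RingHom.map_mulVec (evalRingHom t) A a i

-- If `B` is a right inverse of `A(0)`, then `M = A B` has determinant `1` at `0`, and
-- `det M • e₀ - B adj(M) A e₀` is in the kernel of `A`.
theorem exists_polynomial_mulVec_eq_zero [Finite ι] [Fintype κ]
    {A : Matrix ι κ R[X]} (h : Function.Surjective (A.map (Polynomial.eval 0)).mulVec)
    {e₀ : κ → R} (h₀ : A.map (Polynomial.eval 0) *ᵥ e₀ = 0) :
    ∃ e : κ → R[X], evalAt 0 e = e₀ ∧ ∀ t, A.map (Polynomial.eval t) *ᵥ evalAt t e = 0 := by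
  classical
  cases nonempty_fintype ι
  obtain ⟨B, hB⟩ := mulVec_surjective_iff_exists_right_inverse.1 h
  let B' : Matrix κ ι R[X] := B.map Polynomial.C
  let M := A * B'
  let e' : κ → R[X] := fun i => Polynomial.C (e₀ i)
  have heval : ∀ b : ι → R[X], evalAt 0 (B' *ᵥ b) = B *ᵥ evalAt 0 b := fun b => by
    rw [evalAt_mulVec, Matrix.map_map]
    congr 1
    ext
    simp
  have he' : evalAt 0 e' = e₀ := funext fun _ => eval_C
  have hM : M.map (Polynomial.eval 0) = 1 := by
    rw [← hB]
    ext i j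
    simp [M, B', mul_apply, eval_finsetSum]
  have hdet : M.det.eval 0 = 1 := by
    rw [← coe_evalRingHom, RingHom.map_det, RingHom.mapMatrix_apply, coe_evalRingHom, hM, det_one]
  have hadj : evalAt 0 (B' *ᵥ (M.adjugate *ᵥ (A *ᵥ e'))) = 0 := by
    rw [heval, evalAt_mulVec, evalAt_mulVec, he', h₀, mulVec_zero, mulVec_zero]
  refine ⟨M.det • e' - B' *ᵥ (M.adjugate *ᵥ (A *ᵥ e')), ?_, fun t => ?_⟩
  · funext i
    have hi := congrFun hadj i
    rw [evalAt, Pi.zero_apply] at hi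
    rw [evalAt, Pi.sub_apply, Pi.smul_apply, smul_eq_mul, Polynomial.eval_sub, hi, sub_zero,
      Polynomial.eval_mul, hdet, one_mul, Polynomial.eval_C]
  · rw [← evalAt_mulVec, mulVec_sub, mulVec_smul, mulVec_mulVec, mulVec_mulVec, mul_adjugate,
      smul_mulVec, one_mulVec, sub_self]
    exact funext fun _ => eval_zero

variable {d k m : ℕ}

theorem exists_polynomial_apolar (hkm : k + m = d) {ν : Fin (d + 1) → 𝕜}
    (hν : Function.Surjective (hankel hkm ν).mulVec) (μ : Fin (d + 1) → 𝕜)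
    {g₀ : Fin (k + 1) → 𝕜} (hg₀ : ν ∈ annihilator d m g₀) :
    ∃ g : Fin (k + 1) → 𝕜[X], evalAt 0 g = g₀ ∧
      ∀ t, ν + t • μ ∈ annihilator d m (evalAt t g) := by
  let N : Fin (d + 1) → 𝕜[X] := fun l => Polynomial.C (ν l) + Polynomial.X * Polynomial.C (μ l)
  have hN : ∀ t, (hankel hkm N).map (Polynomial.eval t) = hankel hkm (ν + t • μ) := fun t => by
    ext i j
    simp [hankel, N]
    ring
  have h0 : ν + (0 : 𝕜) • μ = ν := by rw [zero_smul, add_zero]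
  obtain ⟨g, hg, hgt⟩ := exists_polynomial_mulVec_eq_zero (A := hankel hkm N)
    (by rwa [hN, h0]) (e₀ := g₀) (by rwa [hN, h0, hankel_mulVec_eq_zero_iff])
  exact ⟨g, hg, fun t => (hankel_mulVec_eq_zero_iff hkm).1 (by rw [← hN, hgt])⟩

theorem exists_polynomial_mem_annihilator (hkm : k + m = d) {g : Fin (k + 1) → 𝕜[X]}
    (hg : evalAt 0 g ≠ 0) {α : Fin (d + 1) → 𝕜} (hα : α ∈ annihilator d m (evalAt 0 g)) :
    ∃ a : Fin (d + 1) → 𝕜[X], evalAt 0 a = α ∧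
      ∀ t, evalAt t a ∈ annihilator d m (evalAt t g) := by
  have hA : ∀ t, (mulMatrix d m g)ᵀ.map (Polynomial.eval t) = (mulMatrix d m (evalAt t g))ᵀ :=
    fun t => by
      ext i j
      simp [mulMatrix, evalAt, eval_finsetSum, apply_ite (Polynomial.eval t)]
  have hmulVec : ∀ t (ν : Fin (d + 1) → 𝕜),
      (mulMatrix d m g)ᵀ.map (Polynomial.eval t) *ᵥ ν = contract m (evalAt t g) ν := fun t ν => by
    rw [hA, mulVec_transpose, contract_eq_vecMul]
  obtain ⟨a, ha, hat⟩ := exists_polynomial_mulVec_eq_zero (A := (mulMatrix d m g)ᵀ) (e₀ := α)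
    (fun w => (contract_surjective hkm hg w).imp fun ν hν => (hmulVec 0 ν).trans hν)
    (by rw [hmulVec, mem_annihilator.1 hα])
  exact ⟨a, ha, fun t => mem_annihilator.2 (by rw [← hmulVec, hat])⟩

theorem eventually_eval_ne_zero {p : 𝕜[X]} (hp : p ≠ 0) : ∀ᶠ t in cofinite, p.eval t ≠ 0 := by
  simpa [eventually_cofinite, IsRoot] using finite_setOfPred_isRoot hp

theorem eventually_evalAt_ne_zero {a : ι → 𝕜[X]} (h : evalAt 0 a ≠ 0) :
    ∀ᶠ t in cofinite, evalAt t a ≠ 0 := by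
  obtain ⟨i, hi⟩ := Function.ne_iff.1 h
  have hai : a i ≠ 0 := fun h => hi (by simp [evalAt, h])
  exact (eventually_eval_ne_zero hai).mono fun t ht h => ht (congrFun h i)

end PolynomialFamilies

namespace LineIn

open Polynomial Filter

variable {n : ℕ}

theorem linearIndependent_of_pluecker_ne_zero {v w : Fin (n + 1) → ℂ} (h : pluecker v w ≠ 0) :
    LinearIndependent ℂ ![v, w] := by
  obtain ⟨p, hp⟩ := Function.ne_iff.1 h
  rw [LinearIndependent.pair_iff]
  intro s t hst
  have h₁ := congrFun hst p.1
  have h₂ := congrFun hst p.2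
  simp only [Pi.add_apply, Pi.smul_apply, smul_eq_mul, Pi.zero_apply] at h₁ h₂
  have hs : s * pluecker v w p = 0 := by
    rw [pluecker]
    linear_combination w p.2 * h₁ - w p.1 * h₂
  have ht : t * pluecker v w p = 0 := by
    rw [pluecker]
    linear_combination v p.1 * h₂ - v p.2 * h₁
  exact ⟨(mul_eq_zero.1 hs).resolve_right hp, (mul_eq_zero.1 ht).resolve_right hp⟩

theorem pluecker_ne_zero {v w : Fin (n + 1) → ℂ} (h : LinearIndependent ℂ ![v, w]) :
    pluecker v w ≠ 0 := by
  intro h0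
  have hv : v ≠ 0 := h.ne_zero 0
  obtain ⟨i, hi⟩ := Function.ne_iff.1 hv
  refine (LinearIndependent.pair_iff' hv).1 h (w i / v i) (funext fun j => ?_)
  have hij : v i * w j - v j * w i = 0 := congrFun h0 (i, j)
  have hi : v i ≠ 0 := hi
  simp only [Pi.smul_apply, smul_eq_mul]
  field_simp
  linear_combination -hij

/-- The Plücker coordinates of the family of lines spanned by two polynomial families. -/
def polynomialPluecker (a b : Fin (n + 1) → ℂ[X]) : Fin (n + 1) × Fin (n + 1) → ℂ[X] :=
  fun p => a p.1 * b p.2 - a p.2 * b p.1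

theorem evalAt_polynomialPluecker (a b : Fin (n + 1) → ℂ[X]) (t : ℂ) :
    evalAt t (polynomialPluecker a b) = pluecker (evalAt t a) (evalAt t b) := by
  funext p
  simp [evalAt, polynomialPluecker, pluecker]

theorem eventually_linearIndependent {a b : Fin (n + 1) → ℂ[X]}
    (h : LinearIndependent ℂ ![evalAt 0 a, evalAt 0 b]) :
    ∀ᶠ t in cofinite, LinearIndependent ℂ ![evalAt t a, evalAt t b] := by
  have hne := pluecker_ne_zero h
  rw [← evalAt_polynomialPluecker] at hne
  filter_upwards [eventually_evalAt_ne_zero hne] with t ht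
  rw [evalAt_polynomialPluecker] at ht
  exact linearIndependent_of_pluecker_ne_zero ht

theorem eval_pluecker_eq_zero_of_frequently {a b : Fin (n + 1) → ℂ[X]}
    {F : MvPolynomial (Fin (n + 1) × Fin (n + 1)) ℂ}
    (h : ∃ᶠ t in cofinite, MvPolynomial.eval (pluecker (evalAt t a) (evalAt t b)) F = 0) (t : ℂ) :
    MvPolynomial.eval (pluecker (evalAt t a) (evalAt t b)) F = 0 := by
  have heval : ∀ t, (aeval (polynomialPluecker a b) F).eval t =
      MvPolynomial.eval (pluecker (evalAt t a) (evalAt t b)) F := fun t => by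
    rw [← coe_evalRingHom, MvPolynomial.aeval_def, MvPolynomial.hom_eval₂,
      ← evalAt_polynomialPluecker, MvPolynomial.eval]
    congr 1
    ext z
    simp
  simp only [← heval] at h ⊢
  by_contra hne
  exact h (eventually_eval_ne_zero fun h0 => hne (by rw [h0, Polynomial.eval_zero]))

end LineIn

section Pencils

variable {𝕜 V W : Type*} [Field 𝕜] [AddCommGroup V] [Module 𝕜 V] [AddCommGroup W] [Module 𝕜 W]
  {ν μ : V}

theorem add_smul_ne_zero (h : LinearIndependent 𝕜 ![ν, μ]) (t : 𝕜) : ν + t • μ ≠ 0 := fun h0 =>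
  one_ne_zero (LinearIndependent.pair_iff.1 h 1 t (by rw [one_smul, h0])).1

theorem add_smul_mem_ker {T : V →ₗ[𝕜] W} (hν : T ν = 0) (hμ : T μ = 0) (t : 𝕜) :
    ν + t • μ ∈ LinearMap.ker T :=
  (LinearMap.ker T).add_mem hν ((LinearMap.ker T).smul_mem t hμ)

end Pencils

namespace SmoothRationalCurve

open Matrix Filter

section

variable {n : ℕ} (C : SmoothRationalCurve n 5)

/-- The trisecant lines which come from a functional `ν` in the kernel of `C.spanMap`. -/
def trisecantsOf (ν : Fin (5 + 1) → ℂ) : Set (LineIn n) :=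
  {L | ∃ g : Fin (3 + 1) → ℂ, g ≠ 0 ∧ ν ∈ annihilator 5 2 g ∧
    L.1 = (annihilator 5 2 g).map C.spanMap}

variable {C}

theorem subsingleton_trisecantsOf {ν : Fin (5 + 1) → ℂ} (hν : C.spanMap ν = 0) (hν₀ : ν ≠ 0) :
    (C.trisecantsOf ν).Subsingleton := by
  rintro L ⟨g, hg, h, hL⟩ M ⟨g', hg', h', hM⟩
  apply Subtype.ext
  rw [hL, hM, C.isSeparating_ker_spanMap.annihilator_eq_of_mem hν hν₀ hg hg' h h']

theorem trisecantsOf_smul {ν : Fin (5 + 1) → ℂ} {a : ℂ} (ha : a ≠ 0) :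
    C.trisecantsOf (a • ν) = C.trisecantsOf ν := by
  simp only [trisecantsOf, Submodule.smul_mem_iff _ ha]

theorem isSecant_three_iff_exists_mem_trisecantsOf {L : LineIn n} :
    C.IsSecant 3 L ↔ ∃ ν, ν ≠ 0 ∧ C.spanMap ν = 0 ∧ L ∈ C.trisecantsOf ν :=
  C.isSecant_three_iff rfl L

theorem exists_polynomial_mem_trisecantsOf {ν μ : Fin (5 + 1) → ℂ} (hν : C.spanMap ν = 0)
    (hμ : C.spanMap μ = 0) (hli : LinearIndependent ℂ ![ν, μ]) {L : LineIn n}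
    (hL : L ∈ C.trisecantsOf ν) {v : Fin (n + 1) → ℂ} (hv : v ∈ L.1) :
    ∃ a : Fin (n + 1) → Polynomial ℂ, evalAt 0 a = v ∧
      ∀ᶠ t in cofinite, ∀ M ∈ C.trisecantsOf (ν + t • μ), evalAt t a ∈ M.1 := by
  obtain ⟨g₀, hg₀, hνg₀, hLg₀⟩ := hL
  obtain ⟨α, hα, rfl⟩ : v ∈ (annihilator 5 2 g₀).map C.spanMap := hLg₀ ▸ hv
  have hsep := C.isSeparating_ker_spanMap
  obtain ⟨g, rfl, hνg⟩ := exists_polynomial_apolar _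
    (hsep.hankel_mulVec_surjective hν (hli.ne_zero 0)) μ hνg₀
  obtain ⟨a, rfl, hag⟩ := exists_polynomial_mem_annihilator (rfl : 3 + 2 = 5) hg₀ hα
  have hmap : ∀ t, evalAt t (C.coeffMatrix.map Polynomial.C *ᵥ a) = C.spanMap (evalAt t a) :=
    fun t => by
      rw [evalAt_mulVec, spanMap, mulVecLin_apply, Matrix.map_map]
      congr 1
      ext
      simp
  refine ⟨C.coeffMatrix.map Polynomial.C *ᵥ a, hmap 0, ?_⟩
  filter_upwards [eventually_evalAt_ne_zero hg₀] with t ht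
  rintro M ⟨g', hg', hg't, hM⟩
  rw [hM, hmap, hsep.annihilator_eq_of_mem (add_smul_mem_ker hν hμ t) (add_smul_ne_zero hli t) ht
    hg' (hνg t) hg't]
  exact ⟨_, hag t, rfl⟩

end

variable {C : SmoothRationalCurve 3 5}

theorem exists_pencil {ν : Fin (5 + 1) → ℂ} (hν : C.spanMap ν = 0) (hν₀ : ν ≠ 0) :
    ∃ μ, C.spanMap μ = 0 ∧ LinearIndependent ℂ ![ν, μ] ∧
      ∀ κ, C.spanMap κ = 0 → ∃ a b : ℂ, κ = a • ν + b • μ := by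
  have hker := C.finrank_ker_spanMap
  obtain ⟨⟨μ, hμ⟩, hli⟩ := exists_linearIndependent_pair_of_one_lt_finrank
    (R := ℂ) (M := LinearMap.ker C.spanMap) (by lia) (x := ⟨ν, hν⟩)
    (fun h => hν₀ (congrArg Subtype.val h))
  have hspan := hli.span_eq_top_of_card_eq_finrank (by simp [hker])
  refine ⟨μ, hμ, ?_, fun κ hκ => ?_⟩
  · rw [LinearIndependent.pair_iff] at hli ⊢
    exact fun s t hst => hli s t (Subtype.ext hst)
  · have hmem : (⟨κ, hκ⟩ : LinearMap.ker C.spanMap) ∈ Submodule.span ℂ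
        (Set.range ![(⟨ν, hν⟩ : LinearMap.ker C.spanMap), ⟨μ, hμ⟩]) := hspan ▸ Submodule.mem_top
    rw [Matrix.range_cons_cons_empty, Submodule.mem_span_pair] at hmem
    obtain ⟨a, b, hab⟩ := hmem
    exact ⟨a, b, (congrArg Subtype.val hab).symm⟩

theorem frequently_exists_mem_trisecantsOf {Z : Set (LineIn 3)} (hZ : Z.Infinite)
    (hZC : Z ⊆ C.secantLines 3) {ν μ : Fin (5 + 1) → ℂ} (hν : C.spanMap ν = 0)
    (hμ : C.spanMap μ = 0) (hli : LinearIndependent ℂ ![ν, μ])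
    (hspan : ∀ κ, C.spanMap κ = 0 → ∃ a b : ℂ, κ = a • ν + b • μ) :
    ∃ᶠ t : ℂ in cofinite, ∃ L ∈ Z, L ∈ C.trisecantsOf (ν + t • μ) := by
  rw [frequently_cofinite_iff_infinite]
  intro hfin
  have hsub : ∀ t : ℂ, (C.trisecantsOf (ν + t • μ)).Finite := fun t =>
    (subsingleton_trisecantsOf (add_smul_mem_ker hν hμ t) (add_smul_ne_zero hli t)).finite
  refine hZ (((hfin.biUnion fun t _ => hsub t).union
    (subsingleton_trisecantsOf hμ (hli.ne_zero 1)).finite).subset fun L hL => ?_)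
  obtain ⟨κ, hκ₀, hκ, hLκ⟩ := isSecant_three_iff_exists_mem_trisecantsOf.1 (hZC hL)
  obtain ⟨a, b, rfl⟩ := hspan κ hκ
  rcases eq_or_ne a 0 with rfl | ha
  · right
    rw [zero_smul, zero_add] at hLκ hκ₀
    rwa [trisecantsOf_smul fun h => hκ₀ (by rw [h, zero_smul])] at hLκ
  · left
    rw [show a • ν + b • μ = a • (ν + (b / a) • μ) by
      rw [smul_add, smul_smul, mul_div_cancel₀ _ ha], trisecantsOf_smul ha] at hLκ
    exact Set.mem_biUnion ⟨L, hL, hLκ⟩ hLκ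

theorem vanishes_of_infinite {F : MvPolynomial (Fin 4 × Fin 4) ℂ} {Z : Set (LineIn 3)}
    (hZ : Z.Infinite) (hZC : Z ⊆ C.secantLines 3) (hF : ∀ L ∈ Z, LineIn.Vanishes F L)
    {L₀ : LineIn 3} (hL₀ : C.IsSecant 3 L₀) : LineIn.Vanishes F L₀ := by
  obtain ⟨ν, hν₀, hν, hL₀ν⟩ := isSecant_three_iff_exists_mem_trisecantsOf.1 hL₀
  obtain ⟨μ, hμ, hli, hspan⟩ := exists_pencil hν hν₀
  intro v hv w hw hvw
  obtain ⟨a, rfl, ha⟩ := exists_polynomial_mem_trisecantsOf hν hμ hli hL₀ν hv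
  obtain ⟨b, rfl, hb⟩ := exists_polynomial_mem_trisecantsOf hν hμ hli hL₀ν hw
  refine LineIn.eval_pluecker_eq_zero_of_frequently ?_ 0
  refine ((frequently_exists_mem_trisecantsOf hZ hZC hν hμ hli hspan).and_eventually
    (ha.and (hb.and (LineIn.eventually_linearIndependent hvw)))).mono ?_
  rintro t ⟨⟨L, hLZ, hL⟩, hat, hbt, hab⟩
  exact hF L hLZ _ (hat L hL) _ (hbt L hL) hab

end SmoothRationalCurve

/-! ### The Zariski topology on the set of trisecant lines -/

section CofiniteTopology

variable {X : Type*} [TopologicalSpace X] {S : Set X}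

theorem isIrreducible_of_forall_isClosed (hS : S.Infinite)
    (h : ∀ Z, IsClosed Z → (S ∩ Z).Finite ∨ S ⊆ Z) : IsIrreducible S := by
  refine ⟨hS.nonempty, fun U V hU hV hSU hSV => ?_⟩
  have hfinite : ∀ W, IsOpen W → (S ∩ W).Nonempty → (S \ W).Finite := fun W hW ⟨x, hx, hxW⟩ =>
    (h _ hW.isClosed_compl).resolve_right fun hSW => hSW hx hxW
  obtain ⟨x, hx, hxUV⟩ :=
    (hS.sdiff ((hfinite U hU hSU).union (hfinite V hV hSV))).nonempty
  rw [← Set.sdiff_inter] at hxUV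
  exact ⟨x, hx, not_not.1 fun hx' => hxUV ⟨hx, hx'⟩⟩

theorem topologicalKrullDim_eq_one_of_forall_isClosed [T1Space X] [IrreducibleSpace X] [Infinite X]
    (h : ∀ Z : Set X, IsClosed Z → Z.Finite ∨ Z = Set.univ) : topologicalKrullDim X = 1 := by
  apply le_antisymm
  · rw [topologicalKrullDim, Order.krullDim_le_one_iff]
    intro Z
    rcases h Z.1 Z.isClosed with hZ | hZ
    · refine Or.inl fun Y hYZ x hx => ?_
      obtain ⟨y, hy⟩ := Y.isIrreducible.nonempty
      have hsub := hZ.isDiscrete.subsingleton_of_isPreirreducible Z.isIrreducible.isPreirreducible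
      rwa [hsub hx (hYZ hy)]
    · exact Or.inr fun Y _ x _ => (hZ ▸ trivial : x ∈ Z.1)
  · rw [topologicalKrullDim, Order.one_le_krullDim_iff]
    obtain ⟨x⟩ := (inferInstance : Nonempty X)
    refine ⟨⟨{x}, isIrreducible_singleton, isClosed_singleton⟩,
      ⟨Set.univ, IrreducibleSpace.isIrreducible_univ X, isClosed_univ⟩,
      lt_of_le_not_ge (fun _ _ => trivial) fun hle => ?_⟩
    exact Set.infinite_univ ((Set.finite_singleton x).subset hle)

theorem disjoint_or_finite_sdiff_of_generateOpen {X : Type*} {S : Set X} {B : Set (Set X)}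
    (h : ∀ U ∈ B, Disjoint S U ∨ (S \ U).Finite) {U : Set X}
    (hU : TopologicalSpace.GenerateOpen B U) : Disjoint S U ∨ (S \ U).Finite := by
  induction hU with
  | basic U hU => exact h U hU
  | univ => simp
  | inter U V _ _ hU hV =>
    rcases hU with hU | hU
    · exact Or.inl (hU.mono_right Set.inter_subset_left)
    rcases hV with hV | hV
    · exact Or.inl (hV.mono_right Set.inter_subset_right)
    · exact Or.inr (by rw [Set.sdiff_inter]; exact hU.union hV)
  | sUnion s _ hs =>
    by_cases hfin : ∃ U ∈ s, (S \ U).Finite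
    · obtain ⟨U, hU, hfin⟩ := hfin
      exact Or.inr (hfin.subset (Set.sdiff_subset_sdiff_right (Set.subset_sUnion_of_mem hU)))
    · push Not at hfin
      exact Or.inl (Set.disjoint_sUnion_right.2 fun U hU => (hs U hU).resolve_right (hfin U hU))

end CofiniteTopology

namespace LineIn

variable {n : ℕ}

theorem isClosed_vanishes {e : ℕ} {F : MvPolynomial (Fin (n + 1) × Fin (n + 1)) ℂ}
    (hF : F.IsHomogeneous e) : IsClosed {L : LineIn n | Vanishes F L} := by
  rw [← isOpen_compl_iff]
  exact TopologicalSpace.isOpen_generateFrom_of_mem ⟨F, e, hF, rfl⟩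

theorem exists_basis (L : LineIn n) :
    ∃ v w, v ∈ L.1 ∧ w ∈ L.1 ∧ LinearIndependent ℂ ![v, w] := by
  let b := Module.finBasisOfFinrankEq ℂ L.1 L.2
  refine ⟨b 0, b 1, (b 0).2, (b 1).2, ?_⟩
  have hb := b.linearIndependent.map' L.1.subtype (Submodule.ker_subtype _)
  rwa [show ![(b 0 : Fin (n + 1) → ℂ), b 1] = L.1.subtype ∘ b by
    funext j
    fin_cases j <;> rfl]

theorem span_pair_eq (L : LineIn n) {v w : Fin (n + 1) → ℂ} (hv : v ∈ L.1) (hw : w ∈ L.1)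
    (h : LinearIndependent ℂ ![v, w]) : Submodule.span ℂ {v, w} = L.1 := by
  refine Submodule.eq_of_le_of_finrank_le ?_ ?_
  · rw [Submodule.span_le, Set.insert_subset_iff, Set.singleton_subset_iff]
    exact ⟨hv, hw⟩
  · rw [L.2, ← Matrix.range_cons_cons_empty v w ![], finrank_span_eq_card h, Fintype.card_fin]

theorem mem_iff_forall_dualAnnihilator (L : LineIn n) {v : Fin (n + 1) → ℂ} :
    v ∈ L.1 ↔ ∀ ℓ ∈ L.1.dualAnnihilator, ℓ v = 0 := by
  rw [← Submodule.mem_dualCoannihilator, Subspace.dualAnnihilator_dualCoannihilator_eq]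

theorem exists_mem_dualAnnihilator_ne_zero (hn : 2 ≤ n) (L : LineIn n) :
    ∃ ℓ ∈ L.1.dualAnnihilator, ℓ ≠ 0 := by
  have hlt : L.1 < ⊤ := lt_top_iff_ne_top.2 fun h => by
    have hfinrank := L.2
    rw [h, finrank_top, Module.finrank_fin_fun] at hfinrank
    lia
  obtain ⟨ℓ, hℓ, hle⟩ := Submodule.exists_le_ker_of_lt_top _ hlt
  exact ⟨ℓ, (Submodule.mem_dualAnnihilator ℓ).2 fun w hw => hle hw, hℓ⟩

theorem eval_pluecker_sum_dual (ℓ : Module.Dual ℂ (Fin (n + 1) → ℂ)) (j : Fin (n + 1))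
    (v w : Fin (n + 1) → ℂ) :
    eval (pluecker v w) (∑ i, C (ℓ (Pi.single i 1)) * X (i, j)) = ℓ v * w j - ℓ w * v j := by
  obtain ⟨u, rfl⟩ := (dotProductEquiv ℂ _).surjective ℓ
  simp only [dotProductEquiv_apply_apply, dotProduct_single_one]
  simp only [dotProduct, map_sum, map_mul, eval_C, eval_X, pluecker, Finset.sum_mul,
    ← Finset.sum_sub_distrib]
  exact Finset.sum_congr rfl fun i _ => by ring

theorem eq_iff_forall_vanishes {L M : LineIn n} :
    M = L ↔ ∀ ℓ ∈ L.1.dualAnnihilator, ∀ j : Fin (n + 1),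
      Vanishes (∑ i, C (ℓ (Pi.single i 1)) * X (i, j)) M := by
  constructor
  · rintro rfl ℓ hℓ j v hv w hw -
    rw [eval_pluecker_sum_dual, M.mem_iff_forall_dualAnnihilator.1 hv ℓ hℓ,
      M.mem_iff_forall_dualAnnihilator.1 hw ℓ hℓ, zero_mul, zero_mul, sub_zero]
  · intro h
    obtain ⟨v, w, hv, hw, hvw⟩ := M.exists_basis
    have hzero : ∀ ℓ ∈ L.1.dualAnnihilator, -ℓ w = 0 ∧ ℓ v = 0 := fun ℓ hℓ =>
      LinearIndependent.pair_iff.1 hvw _ _ <| funext fun j => by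
        have hj := h ℓ hℓ j v hv w hw hvw
        rw [eval_pluecker_sum_dual] at hj
        simp only [Pi.add_apply, Pi.smul_apply, smul_eq_mul, Pi.zero_apply]
        linear_combination hj
    apply Subtype.ext
    rw [← M.span_pair_eq hv hw hvw, L.span_pair_eq
      (L.mem_iff_forall_dualAnnihilator.2 fun ℓ hℓ => (hzero ℓ hℓ).2)
      (L.mem_iff_forall_dualAnnihilator.2 fun ℓ hℓ => neg_eq_zero.1 (hzero ℓ hℓ).1) hvw]

instance t1Space : T1Space (LineIn n) := by
  refine ⟨fun L => ?_⟩
  have heq : ({L} : Set (LineIn n)) = ⋂ ℓ ∈ L.1.dualAnnihilator, ⋂ j : Fin (n + 1),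
      {M | Vanishes (∑ i, C (ℓ (Pi.single i 1)) * X (i, j)) M} := by
    ext M
    simp only [Set.mem_singleton_iff, Set.mem_iInter, eq_iff_forall_vanishes, Set.mem_ofPred_eq]
  rw [heq]
  exact isClosed_biInter fun ℓ _ => isClosed_iInter fun j => isClosed_vanishes (e := 1) <|
    IsHomogeneous.sum _ _ _ fun i _ => isHomogeneous_C_mul_X _ _

end LineIn

theorem finite_setOf_dvd_associates {R : Type*} [CommRing R] [IsDomain R]
    [UniqueFactorizationMonoid R] {f : R} (hf : f ≠ 0) :
    {d : Associates R | d ∣ Associates.mk f}.Finite := by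
  have := UniqueFactorizationMonoid.fintypeSubtypeDvd _ (Associates.mk_ne_zero.2 hf)
  exact Set.finite_coe_iff.1 (Finite.of_fintype {d : Associates R // d ∣ Associates.mk f})

theorem IsSeparating.eq_of_add_smul_mem_annihilator {𝕜 : Type*} [Field 𝕜] [IsAlgClosed 𝕜]
    {K : Submodule 𝕜 (Fin (5 + 1) → 𝕜)} (hK : IsSeparating K) {ν μ : Fin (5 + 1) → 𝕜} (hν : ν ∈ K)
    (hμ : μ ∈ K) (hli : LinearIndependent 𝕜 ![ν, μ]) {g : Fin (3 + 1) → 𝕜} (hg : g ≠ 0) {s t : 𝕜}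
    (hs : ν + s • μ ∈ annihilator 5 2 g) (ht : ν + t • μ ∈ annihilator 5 2 g) : s = t := by
  obtain ⟨κ, hκ⟩ := finrank_le_one_iff.1 (hK.finrank_inf_annihilator_le (m := 2) rfl hg)
  have hmem : ∀ r : 𝕜, ν + r • μ ∈ K := fun r => K.add_mem hν (K.smul_mem r hμ)
  obtain ⟨a, ha⟩ := hκ ⟨_, hmem s, hs⟩
  obtain ⟨b, hb⟩ := hκ ⟨_, hmem t, ht⟩
  have ha' : a • (κ : Fin (5 + 1) → 𝕜) = ν + s • μ := congrArg Subtype.val ha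
  have hb' : b • (κ : Fin (5 + 1) → 𝕜) = ν + t • μ := congrArg Subtype.val hb
  have ha₀ : a ≠ 0 := fun h => add_smul_ne_zero hli s (by rw [← ha', h, zero_smul])
  have hrel : (b - a) • ν + (b * s - a * t) • μ = 0 := by
    linear_combination (norm := module) a • hb' - b • ha'
  obtain ⟨hba, hst⟩ := LinearIndependent.pair_iff.1 hli _ _ hrel
  rw [sub_eq_zero.1 hba, ← mul_sub] at hst
  exact sub_eq_zero.1 ((mul_eq_zero.1 hst).resolve_left ha₀)

namespace SmoothRationalCurve

theorem restrict_ne_zero {n d : ℕ} {C : SmoothRationalCurve n d}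
    (hC : Function.Surjective C.spanMap) {ℓ : Module.Dual ℂ (Fin (n + 1) → ℂ)} (hℓ : ℓ ≠ 0) :
    C.restrict ℓ ≠ 0 := by
  rw [restrict_eq, Ne, binaryForm_eq_zero_iff]
  refine fun h => hℓ (LinearMap.ext fun v => ?_)
  obtain ⟨ν, rfl⟩ := hC v
  rw [← dotProduct_restrictCoeffs, h, dotProduct_zero, LinearMap.zero_apply]

variable (C : SmoothRationalCurve 3 5)

-- All the cubics of the functionals `ν + t μ` with this trisecant divide one quintic form.
theorem finite_setOf_mem_trisecantsOf {ν μ : Fin (5 + 1) → ℂ} (hν : C.spanMap ν = 0)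
    (hμ : C.spanMap μ = 0) (hli : LinearIndependent ℂ ![ν, μ]) (L : LineIn 3) :
    {t : ℂ | L ∈ C.trisecantsOf (ν + t • μ)}.Finite := by
  obtain ⟨ℓ, hℓ, hℓ₀⟩ := L.exists_mem_dualAnnihilator_ne_zero (by lia)
  have := (finite_setOf_dvd_associates (restrict_ne_zero C.spanMap_surjective hℓ₀)).to_subtype
  choose g hg hνg hLg using fun t : {t : ℂ | L ∈ C.trisecantsOf (ν + t • μ)} => t.2
  have hdvd : ∀ t, binaryForm 3 (g t) ∣ C.restrict ℓ := fun t =>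
    (C.forall_dvd_restrict_iff rfl L (g t)).2 (hLg t).ge ℓ hℓ
  refine Finite.of_injective (fun t => (⟨Associates.mk (binaryForm 3 (g t)),
    Associates.mk_dvd_mk.2 (hdvd t)⟩ : {d | d ∣ Associates.mk (C.restrict ℓ)})) fun s t hst => ?_
  have hle := annihilator_le_of_dvd (rfl : 3 + 2 = 5) (rfl : 3 + 2 = 5)
    (Associates.mk_eq_mk_iff_associated.1 (congrArg Subtype.val hst)).dvd
  exact Subtype.ext (C.isSeparating_ker_spanMap.eq_of_add_smul_mem_annihilator hν hμ hli (hg t)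
    (hle (hνg s)) (hνg t))

theorem infinite_secantLines : (C.secantLines 3).Infinite := by
  have hpos : 0 < Module.finrank ℂ (LinearMap.ker C.spanMap) := by
    rw [C.finrank_ker_spanMap]
    exact two_pos
  obtain ⟨⟨ν, hν⟩, hν₀⟩ := Module.finrank_pos_iff_exists_ne_zero.1 hpos
  obtain ⟨μ, hμ, hli, -⟩ := exists_pencil hν fun h => hν₀ (Subtype.ext h)
  refine fun hfin => Set.infinite_univ ((hfin.biUnion fun L _ =>
    C.finite_setOf_mem_trisecantsOf hν hμ hli L).subset fun t _ => ?_)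
  obtain ⟨L, hL, hLt⟩ := C.exists_isSecant_three (add_smul_ne_zero hli t) (add_smul_mem_ker hν hμ t)
  exact Set.mem_biUnion hL hLt

theorem disjoint_or_finite_secantLines_sdiff {U : Set (LineIn 3)} (hU : IsOpen U) :
    Disjoint (C.secantLines 3) U ∨ (C.secantLines 3 \ U).Finite := by
  refine disjoint_or_finite_sdiff_of_generateOpen ?_ hU
  rintro _ ⟨F, e, -, rfl⟩
  by_cases hfin : (C.secantLines 3 \ {L | ¬ LineIn.Vanishes F L}).Finite
  · exact Or.inr hfin
  · exact Or.inl (Set.disjoint_left.2 fun L hL hLF =>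
      hLF (vanishes_of_infinite hfin Set.sdiff_subset (fun M hM => not_not.1 hM.2) hL))

theorem finite_or_secantLines_subset {Z : Set (LineIn 3)} (hZ : IsClosed Z) :
    (C.secantLines 3 ∩ Z).Finite ∨ C.secantLines 3 ⊆ Z := by
  rw [← Set.sdiff_compl, or_comm, ← Set.disjoint_compl_right_iff_subset]
  exact C.disjoint_or_finite_secantLines_sdiff hZ.isOpen_compl

theorem isIrreducible_secantLines : IsIrreducible (C.secantLines 3) :=
  isIrreducible_of_forall_isClosed C.infinite_secantLines fun _ => C.finite_or_secantLines_subset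

theorem topologicalKrullDim_secantLines : topologicalKrullDim (C.secantLines 3) = 1 := by
  have := C.infinite_secantLines.to_subtype
  have := isIrreducible_iff_irreducibleSpace.1 C.isIrreducible_secantLines
  refine topologicalKrullDim_eq_one_of_forall_isClosed fun S hS => ?_
  obtain ⟨Z, hZ, rfl⟩ := isClosed_induced_iff.1 hS
  refine (C.finite_or_secantLines_subset hZ).imp (fun h => ?_) fun h => ?_
  · refine Set.Finite.of_finite_image (f := Subtype.val) ?_ Subtype.val_injective.injOn
    rwa [Subtype.image_preimage_coe]
  · exact Set.eq_univ_of_forall fun L => h L.2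

end SmoothRationalCurve

/-! ### Sylvester matrices -/

section Sylvester

open Matrix

variable {R 𝕜 : Type*} [CommRing R] [Field 𝕜]

theorem exists_isHomogeneous_dvd [IsAlgClosed 𝕜] {k m : ℕ} {f : MvPolynomial (Fin 2) 𝕜}
    (hf : f.IsHomogeneous (k + m)) : ∃ g, g.IsHomogeneous k ∧ g ∣ f := by
  induction m generalizing f with
  | zero => exact ⟨f, hf, dvd_rfl⟩
  | succ m ih =>
    obtain ⟨x, -, f₁, hf₁, rfl⟩ := exists_eq_linForm_mul_of_isHomogeneous hf
    obtain ⟨g, hg, hgf⟩ := ih hf₁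
    exact ⟨g, hg, hgf.mul_left _⟩

theorem exists_isHomogeneous_dvd_dvd_of_mul_eq_mul [IsAlgClosed 𝕜] {k m m' : ℕ}
    {a b f f' : MvPolynomial (Fin 2) 𝕜} (ha : a.IsHomogeneous m) (hb : b.IsHomogeneous m')
    (hf : f.IsHomogeneous (k + m')) (hf' : f'.IsHomogeneous (k + m)) (ha₀ : a ≠ 0)
    (h : a * f = b * f') : ∃ g, g.IsHomogeneous k ∧ g ∣ f ∧ g ∣ f' := by
  induction m generalizing k m' a b f f' with
  | zero =>
    obtain ⟨c, rfl⟩ : ∃ c, a = C c := ⟨_, totalDegree_eq_zero_iff_eq_C.1 (ha.totalDegree ha₀)⟩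
    have hc : IsUnit (C c : MvPolynomial (Fin 2) 𝕜) :=
      (isUnit_iff_ne_zero.2 fun hc => ha₀ (by rw [hc, C_0])).map C
    exact ⟨f', hf', hc.dvd_mul_left.1 ⟨b, h.trans (mul_comm _ _)⟩, dvd_rfl⟩
  | succ m ih =>
    obtain ⟨x, hx, a, ha₁, rfl⟩ := exists_eq_linForm_mul_of_isHomogeneous ha
    have hlin : linForm x ≠ 0 := left_ne_zero_of_mul ha₀
    rcases eq_or_ne b 0 with rfl | hb₀
    · rw [zero_mul] at h
      rw [(mul_eq_zero.1 h).resolve_left ha₀]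
      obtain ⟨g, hg, hgf'⟩ := exists_isHomogeneous_dvd hf'
      exact ⟨g, hg, dvd_zero g, hgf'⟩
    have hx₀ : eval x b = 0 ∨ eval x f' = 0 := by
      rw [← mul_eq_zero, ← map_mul, ← h, mul_assoc, map_mul, eval_linForm_self, zero_mul]
    rcases hx₀ with hbx | hf'x
    · cases m' with
      | zero =>
        rw [totalDegree_eq_zero_iff_eq_C.1 (hb.totalDegree hb₀), eval_C] at hbx
        rw [totalDegree_eq_zero_iff_eq_C.1 (hb.totalDegree hb₀), hbx, C_0] at hb₀
        exact absurd rfl hb₀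
      | succ m' =>
        obtain ⟨b, hb₁, rfl⟩ := exists_eq_linForm_mul hb hx hbx
        have h₁ : a * f = b * f' := mul_left_cancel₀ hlin (by linear_combination h)
        rw [← add_assoc, add_right_comm] at hf hf'
        obtain ⟨g, hg, hgf, hgf'⟩ := ih ha₁ hb₁ hf hf' (right_ne_zero_of_mul ha₀) h₁
        obtain ⟨g', hg', hg'g⟩ := exists_isHomogeneous_dvd hg
        exact ⟨g', hg', hg'g.trans hgf, hg'g.trans hgf'⟩
    · obtain ⟨f', hf₁', rfl⟩ := exists_eq_linForm_mul hf' hx hf'x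
      have h₁ : a * f = b * f' := mul_left_cancel₀ hlin (by linear_combination h)
      obtain ⟨g, hg, hgf, hgf'⟩ := ih ha₁ hb hf hf₁' (right_ne_zero_of_mul ha₀) h₁
      exact ⟨g, hg, hgf, hgf'.mul_left _⟩

/-- The matrix of `(a, b) ↦ a f + b f'`, from pairs of forms of degree `m` to forms of degree
`e = d + m`. -/
def sylvester {d : ℕ} (e m : ℕ) (f f' : Fin (d + 1) → R) :
    Matrix (Fin (e + 1)) (Fin (m + 1) ⊕ Fin (m + 1)) R :=
  fromCols (mulMatrix e m f) (mulMatrix e m f')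

theorem binaryForm_sylvester_mulVec {d e m : ℕ} (hdm : d + m = e) (f f' : Fin (d + 1) → R)
    (a b : Fin (m + 1) → R) :
    binaryForm e (sylvester e m f f' *ᵥ Sum.elim a b) =
      binaryForm d f * binaryForm m a + binaryForm d f' * binaryForm m b := by
  rw [sylvester, fromCols_mulVec, Sum.elim_comp_inl, Sum.elim_comp_inr, binaryForm_add,
    binaryForm_mulMatrix_mulVec hdm, binaryForm_mulMatrix_mulVec hdm]

theorem exists_sylvester_mulVec_eq_zero_iff [IsAlgClosed 𝕜] {d e k m : ℕ} (hkm : k + m = d)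
    (hdm : d + m = e) (f f' : Fin (d + 1) → 𝕜) :
    (∃ x ≠ 0, sylvester e m f f' *ᵥ x = 0) ↔
      ∃ g : Fin (k + 1) → 𝕜, binaryForm k g ∣ binaryForm d f ∧
        binaryForm k g ∣ binaryForm d f' := by
  constructor
  · rintro ⟨x, hx₀, hx⟩
    obtain ⟨a, b, rfl⟩ : ∃ a b, x = Sum.elim a b := ⟨_, _, (Sum.elim_comp_inl_inr x).symm⟩
    rw [← binaryForm_eq_zero_iff, binaryForm_sylvester_mulVec hdm] at hx
    subst hkm
    obtain ⟨g, hg, hgf, hgf'⟩ : ∃ g, g.IsHomogeneous k ∧ g ∣ binaryForm (k + m) f ∧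
        g ∣ binaryForm (k + m) f' := by
      by_cases ha : a = 0
      · have hb : b ≠ 0 := fun hb => hx₀ (by rw [ha, hb, Sum.elim_zero_zero])
        rw [ha, binaryForm_zero, mul_zero, zero_add, mul_eq_zero, binaryForm_eq_zero_iff (a := b),
          or_iff_left hb] at hx
        obtain ⟨g, hg, hgf⟩ := exists_isHomogeneous_dvd (isHomogeneous_binaryForm f)
        exact ⟨g, hg, hgf, hx ▸ dvd_zero g⟩
      · exact exists_isHomogeneous_dvd_dvd_of_mul_eq_mul (isHomogeneous_binaryForm a)
          (isHomogeneous_binaryForm b).neg (isHomogeneous_binaryForm f)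
          (isHomogeneous_binaryForm f') (mt binaryForm_eq_zero_iff.1 ha)
          (by linear_combination hx)
    obtain ⟨g, rfl⟩ := exists_eq_binaryForm hg
    exact ⟨g, hgf, hgf'⟩
  · rintro ⟨g, hgf, hgf'⟩
    obtain ⟨q, rfl⟩ := (mem_range_mulMatrix_iff_dvd hkm).2 hgf
    obtain ⟨q', rfl⟩ := (mem_range_mulMatrix_iff_dvd hkm).2 hgf'
    obtain hq | hq : Sum.elim q' (-q) = 0 ∨ Sum.elim q' (-q) ≠ 0 := eq_or_ne _ _
    · have hq₀ : q = 0 := neg_eq_zero.1 (congrArg (· ∘ Sum.inr) hq)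
      have hq₀' : q' = 0 := congrArg (· ∘ Sum.inl) hq
      refine ⟨1, one_ne_zero, ?_⟩
      rw [hq₀, hq₀', map_zero, ← binaryForm_eq_zero_iff, ← Sum.elim_one_one,
        binaryForm_sylvester_mulVec hdm, binaryForm_zero, zero_mul, add_zero]
    · refine ⟨_, hq, ?_⟩
      rw [← binaryForm_eq_zero_iff, binaryForm_sylvester_mulVec hdm, mulVecLin_apply,
        mulVecLin_apply, binaryForm_mulMatrix_mulVec hkm, binaryForm_mulMatrix_mulVec hkm,
        ← neg_one_smul 𝕜 q, binaryForm_smul, map_neg, map_one]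
      ring

theorem forall_det_mul_eq_zero_iff {ι κ : Type*} [Fintype ι] [Fintype κ] [DecidableEq κ]
    (A : Matrix ι κ 𝕜) : (∀ ρ : Matrix κ ι 𝕜, (ρ * A).det = 0) ↔ ∃ x ≠ 0, A *ᵥ x = 0 := by
  constructor
  · contrapose!
    intro h
    classical
    have hker : LinearMap.ker A.toLin' = ⊥ :=
      LinearMap.ker_eq_bot'.2 fun x hx => by_contra fun hx₀ => h x hx₀ hx
    obtain ⟨φ, hφ⟩ := A.toLin'.exists_leftInverse_of_injective hker
    refine ⟨LinearMap.toMatrix' φ, ?_⟩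
    rw [← LinearMap.toMatrix'_toLin' A, ← LinearMap.toMatrix'_comp, hφ, LinearMap.toMatrix'_id,
      det_one]
    exact one_ne_zero
  · rintro ⟨x, hx₀, hx⟩ ρ
    exact exists_mulVec_eq_zero_iff.1 ⟨x, hx₀, by rw [← mulVec_mulVec, hx, mulVec_zero]⟩

end Sylvester

theorem map_sylvester {R S : Type*} [CommRing R] [CommRing S] (φ : R →+* S) {d : ℕ} (e m : ℕ)
    (f f' : Fin (d + 1) → R) :
    (sylvester e m f f').map φ = sylvester e m (φ ∘ f) (φ ∘ f') := by
  ext l (i | i) <;> simp [sylvester, mulMatrix, apply_ite φ]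

theorem isHomogeneous_mulMatrix {R σ : Type*} [CommRing R] {d c : ℕ} (e m : ℕ)
    {f : Fin (d + 1) → MvPolynomial σ R} (hf : ∀ l, (f l).IsHomogeneous c) (l : Fin (e + 1))
    (i : Fin (m + 1)) : (mulMatrix e m f l i).IsHomogeneous c := by
  rw [mulMatrix, Matrix.of_apply]
  refine IsHomogeneous.sum _ _ _ fun j _ => ?_
  split_ifs
  · exact hf j
  · exact isHomogeneous_zero _ _ _

theorem isHomogeneous_sylvester {R σ : Type*} [CommRing R] {d c : ℕ} (e m : ℕ)
    {f f' : Fin (d + 1) → MvPolynomial σ R} (hf : ∀ l, (f l).IsHomogeneous c)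
    (hf' : ∀ l, (f' l).IsHomogeneous c) (l : Fin (e + 1)) (i : Fin (m + 1) ⊕ Fin (m + 1)) :
    (sylvester e m f f' l i).IsHomogeneous c := by
  rcases i with i | i
  exacts [isHomogeneous_mulMatrix e m hf l i, isHomogeneous_mulMatrix e m hf' l i]

theorem isHomogeneous_det {R σ κ : Type*} [CommRing R] [Fintype κ] [DecidableEq κ] {c : ℕ}
    {A : Matrix κ κ (MvPolynomial σ R)} (hA : ∀ i j, (A i j).IsHomogeneous c) :
    A.det.IsHomogeneous (Fintype.card κ * c) := by
  rw [Matrix.det_apply]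
  refine IsHomogeneous.sum _ _ _ fun τ _ => ?_
  have hprod := IsHomogeneous.prod Finset.univ (fun i => A (τ i) i) (fun _ => c) fun i _ => hA _ _
  rw [Finset.sum_const, smul_eq_mul, Finset.card_univ] at hprod
  rcases Int.units_eq_one_or (Equiv.Perm.sign τ) with hτ | hτ
  · rwa [hτ, one_smul]
  · rw [hτ, Units.neg_smul, one_smul]
    exact hprod.neg

namespace LineIn

open Matrix

theorem isClosed_setOf_exists_mulVec_eq_zero {n c : ℕ} {ι κ : Type*} [Finite ι] [Fintype κ]
    {A : Matrix ι κ (MvPolynomial (Fin (n + 1) × Fin (n + 1)) ℂ)}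
    (hA : ∀ i j, (A i j).IsHomogeneous c) :
    IsClosed {L : LineIn n | ∀ v ∈ L.1, ∀ w ∈ L.1, LinearIndependent ℂ ![v, w] →
      ∃ x ≠ 0, A.map (eval (pluecker v w)) *ᵥ x = 0} := by
  classical
  cases nonempty_fintype ι
  let ψ : ℂ →+* MvPolynomial (Fin (n + 1) × Fin (n + 1)) ℂ := C
  have hdet : ∀ (ρ : Matrix κ ι ℂ) (p : Fin (n + 1) × Fin (n + 1) → ℂ),
      eval p (ρ.map ψ * A).det = (ρ * A.map (eval p)).det := fun ρ p => by
    rw [RingHom.map_det, RingHom.mapMatrix_apply, Matrix.map_mul, Matrix.map_map]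
    congr 2
    ext i j
    exact eval_C _
  have heq : {L : LineIn n | ∀ v ∈ L.1, ∀ w ∈ L.1, LinearIndependent ℂ ![v, w] →
      ∃ x ≠ 0, A.map (eval (pluecker v w)) *ᵥ x = 0} =
      ⋂ ρ : Matrix κ ι ℂ, {L | Vanishes (ρ.map ψ * A).det L} := by
    ext L
    simp only [Set.mem_iInter, Set.mem_ofPred_eq, Vanishes, hdet, ← forall_det_mul_eq_zero_iff]
    tauto
  rw [heq]
  exact isClosed_iInter fun ρ => isClosed_vanishes <| isHomogeneous_det (c := c) fun i j =>
    IsHomogeneous.sum _ _ _ fun l _ => (hA l j).C_mul _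

theorem mem_dualAnnihilator_iff {n : ℕ} {L : LineIn n} {v w : Fin (n + 1) → ℂ} (hv : v ∈ L.1)
    (hw : w ∈ L.1) (h : LinearIndependent ℂ ![v, w]) {ℓ : Module.Dual ℂ (Fin (n + 1) → ℂ)} :
    ℓ ∈ L.1.dualAnnihilator ↔ ℓ v = 0 ∧ ℓ w = 0 := by
  rw [← L.span_pair_eq hv hw h, Submodule.mem_dualAnnihilator]
  refine ⟨fun hℓ => ⟨hℓ v (Submodule.subset_span (by simp)),
    hℓ w (Submodule.subset_span (by simp))⟩, fun hℓ x hx => ?_⟩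
  obtain ⟨s, t, rfl⟩ := Submodule.mem_span_pair.1 hx
  simp [hℓ]

theorem span_pair_eq_dualAnnihilator (L : LineIn 3) {ℓ ℓ' : Module.Dual ℂ (Fin (3 + 1) → ℂ)}
    (hℓ : ℓ ∈ L.1.dualAnnihilator) (hℓ' : ℓ' ∈ L.1.dualAnnihilator)
    (h : LinearIndependent ℂ ![ℓ, ℓ']) : Submodule.span ℂ {ℓ, ℓ'} = L.1.dualAnnihilator := by
  refine Submodule.eq_of_le_of_finrank_le ?_ ?_
  · rw [Submodule.span_le, Set.insert_subset_iff, Set.singleton_subset_iff]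
    exact ⟨hℓ, hℓ'⟩
  · have hadd := Subspace.finrank_add_finrank_dualAnnihilator_eq L.1
    rw [L.2, Module.finrank_fin_fun] at hadd
    rw [← range_cons_cons_empty ℓ ℓ' ![], finrank_span_eq_card h, Fintype.card_fin]
    lia

/-- The skew-symmetric matrix of dual Plücker coordinates. The rows of the matrix of a line in `ℙ³`
span the linear forms which vanish on it. -/
def dualPluecker {R : Type*} [CommRing R] (p : Fin 4 × Fin 4 → R) : Matrix (Fin 4) (Fin 4) R :=
  !![0, p (2, 3), -p (1, 3), p (1, 2);
    -p (2, 3), 0, p (0, 3), -p (0, 2);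
    p (1, 3), -p (0, 3), 0, p (0, 1);
    -p (1, 2), p (0, 2), -p (0, 1), 0]

theorem map_dualPluecker {R S : Type*} [CommRing R] [CommRing S] (φ : R →+* S)
    (p : Fin 4 × Fin 4 → R) : (dualPluecker p).map φ = dualPluecker (φ ∘ p) := by
  ext i j
  fin_cases i <;> fin_cases j <;> simp [dualPluecker]

theorem isHomogeneous_dualPluecker (i j : Fin 4) :
    (dualPluecker (X : Fin 4 × Fin 4 → MvPolynomial _ ℂ) i j).IsHomogeneous 1 := by
  have hX : ∀ p, (X p : MvPolynomial (Fin 4 × Fin 4) ℂ).IsHomogeneous 1 := isHomogeneous_X ℂ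
  fin_cases i <;> fin_cases j <;>
    simp [dualPluecker, isHomogeneous_zero, hX, (hX _).neg]

theorem dualPluecker_pluecker_mulVec (v w : Fin (3 + 1) → ℂ) :
    dualPluecker (pluecker v w) *ᵥ v = 0 ∧ dualPluecker (pluecker v w) *ᵥ w = 0 := by
  constructor <;> ext k <;> fin_cases k <;>
    simp [mulVec, dotProduct, Fin.sum_univ_four, dualPluecker, pluecker] <;> ring

theorem dualPluecker_dualPluecker_pluecker (v w : Fin (3 + 1) → ℂ) (i j : Fin 4) :
    dualPluecker (fun p => dualPluecker (pluecker v w) p.1 p.2) i j = pluecker v w (i, j) := by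
  fin_cases i <;> fin_cases j <;> simp [dualPluecker, pluecker]

theorem exists_linearIndependent_dualPluecker {v w : Fin (3 + 1) → ℂ}
    (h : LinearIndependent ℂ ![v, w]) : ∃ i j,
      LinearIndependent ℂ ![dualPluecker (pluecker v w) i, dualPluecker (pluecker v w) j] := by
  set Q := dualPluecker (pluecker v w) with hQ
  obtain ⟨i, j, hij⟩ : ∃ i j, Q i j ≠ 0 := by
    by_contra! hQ₀
    refine pluecker_ne_zero h (funext fun p => ?_)
    rw [← dualPluecker_dualPluecker_pluecker, ← hQ, show (fun p : Fin 4 × Fin 4 => Q p.1 p.2) = 0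
      from funext fun p => hQ₀ _ _]
    obtain ⟨i, j⟩ := p
    fin_cases i <;> fin_cases j <;> simp [dualPluecker]
  have hdiag : ∀ k, Q k k = 0 := fun k => by fin_cases k <;> rfl
  have hskew : Q j i = -Q i j := by
    clear hij
    fin_cases i <;> fin_cases j <;> simp [hQ, dualPluecker]
  refine ⟨i, j, linearIndependent_of_pluecker_ne_zero (n := 3)
    (Function.ne_iff.2 ⟨(i, j), ?_⟩)⟩
  simp only [pluecker, hdiag, hskew]
  simpa using hij

end LineIn

namespace SmoothRationalCurve

open Matrix

variable {d k m : ℕ} (C : SmoothRationalCurve 3 d)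

theorem restrictCoeffs_dotProductEquiv {n : ℕ} (C : SmoothRationalCurve n d)
    (u : Fin (n + 1) → ℂ) : C.restrictCoeffs (dotProductEquiv ℂ _ u) = u ᵥ* C.coeffMatrix := by
  refine dotProduct_eq _ _ fun ν => ?_
  rw [dotProduct_comm, dotProduct_restrictCoeffs, ← dotProduct_mulVec]
  rfl

theorem restrict_add_smul {n : ℕ} (C : SmoothRationalCurve n d)
    (ℓ ℓ' : Module.Dual ℂ (Fin (n + 1) → ℂ)) (s t : ℂ) :
    C.restrict (s • ℓ + t • ℓ') =
      MvPolynomial.C s * C.restrict ℓ + MvPolynomial.C t * C.restrict ℓ' := by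
  simp [restrict, add_mul, Finset.sum_add_distrib, Finset.mul_sum, mul_assoc]

/-- The coefficient vectors of the restrictions to the curve of the linear forms given by dual
Plücker coordinates. -/
def dualForms {R : Type*} [CommRing R] [Algebra ℂ R] (p : Fin 4 × Fin 4 → R) :
    Matrix (Fin 4) (Fin (d + 1)) R :=
  LineIn.dualPluecker p * C.coeffMatrix.map (algebraMap ℂ R)

theorem restrict_dualPluecker (p : Fin 4 × Fin 4 → ℂ) (i : Fin 4) :
    C.restrict (dotProductEquiv ℂ _ (LineIn.dualPluecker p i)) =
      binaryForm d (C.dualForms p i) := by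
  rw [restrict_eq, restrictCoeffs_dotProductEquiv]
  rfl

theorem eval_dualForms (p : Fin 4 × Fin 4 → ℂ) (i : Fin 4) :
    eval p ∘ C.dualForms X i = C.dualForms p i := by
  have hX : eval p ∘ X = p := _root_.funext fun q => eval_X q
  have h : (C.dualForms X).map (eval p) = C.dualForms p := by
    rw [dualForms, dualForms, Matrix.map_mul, LineIn.map_dualPluecker, Matrix.map_map, hX]
    congr 2
    ext
    exact eval_C _
  exact congrFun h i

theorem isHomogeneous_dualForms (i : Fin 4) (l : Fin (d + 1)) :
    (C.dualForms (X : Fin 4 × Fin 4 → MvPolynomial _ ℂ) i l).IsHomogeneous 1 := by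
  rw [dualForms, Matrix.mul_apply]
  refine IsHomogeneous.sum _ _ _ fun j _ => ?_
  rw [mul_comm]
  exact (LineIn.isHomogeneous_dualPluecker i j).C_mul _

theorem isSecant_iff_forall_exists_sylvester_mulVec_eq_zero (hC : Function.Surjective C.spanMap)
    (hkm : k + m = d) {L : LineIn 3} {v w : Fin (3 + 1) → ℂ} (hv : v ∈ L.1) (hw : w ∈ L.1)
    (h : LinearIndependent ℂ ![v, w]) :
    C.IsSecant k L ↔ ∀ i j, ∃ x ≠ 0,
      sylvester (d + m) m (C.dualForms (LineIn.pluecker v w) i)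
        (C.dualForms (LineIn.pluecker v w) j) *ᵥ x = 0 := by
  set p := LineIn.pluecker v w
  simp only [exists_sylvester_mulVec_eq_zero_iff hkm rfl, ← restrict_dualPluecker]
  have hmem : ∀ i, dotProductEquiv ℂ _ (LineIn.dualPluecker p i) ∈ L.1.dualAnnihilator := fun i =>
    (LineIn.mem_dualAnnihilator_iff hv hw h).2
      ⟨congrFun (LineIn.dualPluecker_pluecker_mulVec v w).1 i,
        congrFun (LineIn.dualPluecker_pluecker_mulVec v w).2 i⟩
  constructor
  · rintro ⟨g, -, hg, hdvd⟩ i j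
    obtain ⟨g, rfl⟩ := exists_eq_binaryForm hg
    exact ⟨g, hdvd _ (hmem i), hdvd _ (hmem j)⟩
  · intro hdvd
    obtain ⟨i, j, hij⟩ := LineIn.exists_linearIndependent_dualPluecker h
    obtain ⟨g, hgi, hgj⟩ := hdvd i j
    have hij' := hij.map' (dotProductEquiv ℂ (Fin 4)).toLinearMap (LinearEquiv.ker _)
    rw [← FinVec.map_eq] at hij'
    change LinearIndependent ℂ ![_, _] at hij'
    refine ⟨binaryForm k g, ?_, isHomogeneous_binaryForm g, fun ℓ hℓ => ?_⟩
    · exact ne_zero_of_dvd_ne_zero (restrict_ne_zero hC (hij'.ne_zero 0)) hgi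
    · rw [← L.span_pair_eq_dualAnnihilator (hmem i) (hmem j) hij', Submodule.mem_span_pair] at hℓ
      obtain ⟨s, t, rfl⟩ := hℓ
      rw [restrict_add_smul]
      exact dvd_add (hgi.mul_left _) (hgj.mul_left _)

theorem isClosed_secantLines (hC : Function.Surjective C.spanMap) (hkm : k + m = d) :
    IsClosed (C.secantLines k) := by
  have heq : C.secantLines k = ⋂ i, ⋂ j, {L | ∀ v ∈ L.1, ∀ w ∈ L.1, LinearIndependent ℂ ![v, w] →
      ∃ x ≠ 0, (sylvester (d + m) m (C.dualForms X i) (C.dualForms X j)).map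
        (eval (LineIn.pluecker v w)) *ᵥ x = 0} := by
    ext L
    simp only [Set.mem_iInter, Set.mem_ofPred_eq, map_sylvester]
    conv_rhs => enter [i, j, v, hv, w, hw, h, 1, x]; rw [eval_dualForms, eval_dualForms]
    refine ⟨fun hL i j v hv w hw h =>
      (C.isSecant_iff_forall_exists_sylvester_mulVec_eq_zero hC hkm hv hw h).1 hL i j, fun hL => ?_⟩
    obtain ⟨v, w, hv, hw, h⟩ := L.exists_basis
    exact (C.isSecant_iff_forall_exists_sylvester_mulVec_eq_zero hC hkm hv hw h).2
      fun i j => hL i j v hv w hw h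
  rw [heq]
  exact isClosed_iInter fun i => isClosed_iInter fun j =>
    LineIn.isClosed_setOf_exists_mulVec_eq_zero
      (isHomogeneous_sylvester _ _ (C.isHomogeneous_dualForms i) (C.isHomogeneous_dualForms j))

end SmoothRationalCurve

/-! ### Curves all of whose trisecant lines are four-secant -/

section Segre

open Matrix

variable {𝕜 : Type*} [Field 𝕜] {d k m : ℕ}

theorem contract_evalVec (hkm : k + m = d) (g : Fin (k + 1) → 𝕜) (x : Fin 2 → 𝕜) :
    contract m g (evalVec d x) = eval x (binaryForm k g) • evalVec m x := by
  refine dotProduct_eq _ _ fun h => ?_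
  rw [← dotProduct_mulMatrix_mulVec, dotProduct_comm, dotProduct_evalVec,
    binaryForm_mulMatrix_mulVec hkm, map_mul, smul_dotProduct, dotProduct_comm, dotProduct_evalVec,
    smul_eq_mul]

theorem mem_annihilator_iff_of_eq_mul {l n e : ℕ} (hkn : k + n = d) (hlm : l + m = n)
    (hem : e + m = d) {g : Fin (k + 1) → 𝕜} {p : Fin (l + 1) → 𝕜} {f : Fin (e + 1) → 𝕜}
    (hf : binaryForm e f = binaryForm k g * binaryForm l p) {ν : Fin (d + 1) → 𝕜} :
    ν ∈ annihilator d m f ↔ contract n g ν ∈ annihilator n m p := by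
  have hmul : ∀ h, mulMatrix d m f *ᵥ h = mulMatrix d n g *ᵥ (mulMatrix n m p *ᵥ h) := fun h => by
    apply binaryForm_injective
    rw [binaryForm_mulMatrix_mulVec hem, binaryForm_mulMatrix_mulVec hkn,
      binaryForm_mulMatrix_mulVec hlm, hf, mul_assoc]
  simp only [mem_annihilator, ← dotProduct_eq_zero_iff, ← dotProduct_mulMatrix_mulVec, hmul]

theorem IsSeparating.annihilator_eq_of_common_dvd [IsAlgClosed 𝕜]
    {K : Submodule 𝕜 (Fin (d + 1) → 𝕜)} (hK : IsSeparating K) (hkm : k + 3 + m = d)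
    (hk : k < Module.finrank 𝕜 K) {g : Fin (k + 2 + 1) → 𝕜} {f f' : Fin (k + 3 + 1) → 𝕜}
    (hf₀ : f ≠ 0) (hf₀' : f' ≠ 0) (hf : binaryForm (k + 2) g ∣ binaryForm (k + 3) f)
    (hf' : binaryForm (k + 2) g ∣ binaryForm (k + 3) f') (hKf : K ≤ annihilator d m f)
    (hKf' : K ≤ annihilator d m f') : annihilator d m f = annihilator d m f' := by
  have hkm' : k + 2 + (1 + m) = d := by lia
  have hg : g ≠ 0 := by
    rintro rfl
    rw [binaryForm_zero, zero_dvd_iff, binaryForm_eq_zero_iff] at hf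
    exact hf₀ hf
  obtain ⟨ν, hν, hνg⟩ : ∃ ν ∈ K, contract (1 + m) g ν ≠ 0 := by
    by_contra! h
    have hle := hK.finrank_inf_annihilator_le hkm' hg
    rw [inf_eq_left.2 fun ν hν => mem_annihilator.2 (h ν hν)] at hle
    exact absurd hk hle.not_gt
  suffices h : ∀ f : Fin (k + 3 + 1) → 𝕜, f ≠ 0 → binaryForm (k + 2) g ∣ binaryForm (k + 3) f →
      K ≤ annihilator d m f →
      annihilator d m f = (Submodule.span 𝕜 {contract (1 + m) g ν}).comap (contract (1 + m) g) from
    (h f hf₀ hf hKf).trans (h f' hf₀' hf' hKf').symm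
  intro f hf₀ hf hKf
  obtain ⟨p, hp, hfp⟩ := exists_isHomogeneous_eq_mul_of_dvd (m := 1)
    (isHomogeneous_binaryForm f) (isHomogeneous_binaryForm g) hf
  obtain ⟨p, rfl⟩ := exists_eq_binaryForm hp
  have hp₀ : p ≠ 0 := by
    rintro rfl
    rw [binaryForm_zero, mul_zero, binaryForm_eq_zero_iff] at hfp
    exact hf₀ hfp
  have hiff := fun ν => mem_annihilator_iff_of_eq_mul hkm' rfl hkm hfp (ν := ν)
  have hspan : Submodule.span 𝕜 {contract (1 + m) g ν} = annihilator (1 + m) m p :=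
    Submodule.eq_of_le_of_finrank_eq
      (by simpa [Submodule.span_singleton_le_iff_mem] using (hiff ν).1 (hKf hν))
      (by rw [finrank_span_singleton hνg, finrank_annihilator rfl hp₀])
  ext μ
  rw [hspan, Submodule.mem_comap, hiff]

theorem evalVec_one (x : Fin 2 → 𝕜) : evalVec 1 x = x ∘ Fin.rev := by
  ext i
  fin_cases i <;> simp [evalVec]

/-- The contractions of a functional with two forms, as the rows of a `2 × 2` matrix. It is the
linear projection which maps the rational normal curve to a curve `[x] ↦ [f(x) xᵀ]` on the Segre
surface; the columns are interchanged since `evalVec 1 x = (x₁, x₀)`. -/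
def segreProjection (d : ℕ) (f : Fin 2 → Fin (k + 1) → 𝕜) :
    (Fin (d + 1) → 𝕜) →ₗ[𝕜] Matrix (Fin 2) (Fin 2) 𝕜 :=
  LinearMap.pi fun j => LinearMap.funLeft 𝕜 𝕜 Fin.rev ∘ₗ contract 1 (f j)

theorem segreProjection_evalVec (hk : k + 1 = d) (f : Fin 2 → Fin (k + 1) → 𝕜) (x : Fin 2 → 𝕜) :
    segreProjection d f (evalVec d x) = vecMulVec (fun j => eval x (binaryForm k (f j))) x := by
  ext j i
  change contract 1 (f j) (evalVec d x) i.rev = _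
  rw [contract_evalVec hk, evalVec_one, Pi.smul_apply, Function.comp_apply, Fin.rev_rev]
  rfl

theorem le_ker_segreProjection {K : Submodule 𝕜 (Fin (d + 1) → 𝕜)} {f : Fin 2 → Fin (k + 1) → 𝕜}
    (h : ∀ j, K ≤ annihilator d 1 (f j)) : K ≤ LinearMap.ker (segreProjection d f) := fun ν hν => by
  ext j i
  exact congrFun (mem_annihilator.1 (h j hν)) i.rev

theorem segreProjection_surjective [IsAlgClosed 𝕜] (hk : k + 1 + 1 = d)
    {f : Fin 2 → Fin (k + 1 + 1) → 𝕜} (h : ∀ g : Fin (k + 1) → 𝕜,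
      ¬ (binaryForm k g ∣ binaryForm (k + 1) (f 0) ∧ binaryForm k g ∣ binaryForm (k + 1) (f 1))) :
    Function.Surjective (segreProjection d f) := fun M => by
  obtain ⟨ν, hν⟩ : Sum.elim (M 0 ∘ Fin.rev) (M 1 ∘ Fin.rev) ∈
      LinearMap.range (sylvester d 1 (f 0) (f 1))ᵀ.mulVecLin := by
    rw [mem_range_mulVecLin_iff]
    intro x hx
    rw [vecMul_transpose] at hx
    by_contra hxM
    obtain ⟨g, hg⟩ := (exists_sylvester_mulVec_eq_zero_iff rfl hk (f 0) (f 1)).1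
      ⟨x, fun hx₀ => hxM (by rw [hx₀, zero_dotProduct]), hx⟩
    exact h g hg
  rw [mulVecLin_apply, mulVec_transpose, sylvester, vecMul_fromCols, ← contract_eq_vecMul,
    ← contract_eq_vecMul] at hν
  refine ⟨ν, ?_⟩
  ext j i
  change contract 1 (f j) ν i.rev = M j i
  fin_cases j
  · simpa using congrFun hν (Sum.inl i.rev)
  · simpa using congrFun hν (Sum.inr i.rev)

end Segre

namespace SmoothRationalCurve

variable (C : SmoothRationalCurve 3 5)

theorem exists_eq_map_annihilator_of_isSecant_four {L : LineIn 3} (hL : C.IsSecant 4 L) :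
    ∃ f : Fin (4 + 1) → ℂ, f ≠ 0 ∧ LinearMap.ker C.spanMap ≤ annihilator 5 1 f ∧
      L.1 = (annihilator 5 1 f).map C.spanMap := by
  obtain ⟨f, hf, hle⟩ := (C.isSecant_iff (rfl : 4 + 1 = 5) L).1 hL
  have hK := C.finrank_ker_spanMap
  have hinf : LinearMap.ker C.spanMap ⊓ annihilator 5 1 f = LinearMap.ker C.spanMap :=
    Submodule.eq_of_le_of_finrank_le inf_le_left (by
      have := C.le_finrank_inf_annihilator rfl hf hle
      lia)
  refine ⟨f, hf, inf_eq_left.1 hinf, (Submodule.eq_of_le_of_finrank_le hle ?_).symm⟩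
  have hmap := finrank_map_add_finrank_ker_inf C.spanMap (annihilator 5 1 f)
  rw [finrank_annihilator (rfl : 4 + 1 = 5) hf, hinf, hK] at hmap
  rw [L.2]
  lia

theorem exists_segreProjection_surjective (h : ∀ L : LineIn 3, C.IsSecant 3 L → C.IsSecant 4 L) :
    ∃ f : Fin 2 → Fin (4 + 1) → ℂ, Function.Surjective (segreProjection 5 f) ∧
      LinearMap.ker C.spanMap ≤ LinearMap.ker (segreProjection 5 f) := by
  obtain ⟨L₀, hL₀, L₁, hL₁, hne⟩ := C.infinite_secantLines.nontrivial
  obtain ⟨f₀, hf₀, hK₀, hLf₀⟩ := C.exists_eq_map_annihilator_of_isSecant_four (h L₀ hL₀)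
  obtain ⟨f₁, hf₁, hK₁, hLf₁⟩ := C.exists_eq_map_annihilator_of_isSecant_four (h L₁ hL₁)
  refine ⟨![f₀, f₁], segreProjection_surjective rfl ?_,
    le_ker_segreProjection (Fin.forall_fin_two.2 ⟨hK₀, hK₁⟩)⟩
  rintro g ⟨hg₀, hg₁⟩
  refine hne (Subtype.ext ?_)
  rw [hLf₀, hLf₁, C.isSeparating_ker_spanMap.annihilator_eq_of_common_dvd (k := 1) rfl
    (by rw [C.finrank_ker_spanMap]; exact one_lt_two) hf₀ hf₁ hg₀ hg₁ hK₀ hK₁]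

theorem exists_segre_parametrization (h : ∀ L : LineIn 3, C.IsSecant 3 L → C.IsSecant 4 L) :
    ∃ (f : Fin 2 → Fin (4 + 1) → ℂ) (A : Matrix (Fin 2) (Fin 2) ℂ ≃ₗ[ℂ] (Fin 4 → ℂ)),
      ∀ x : Fin 2 → ℂ, A (Matrix.vecMulVec (fun j => eval x (binaryForm 4 (f j))) x) =
        evalForms C.form x := by
  obtain ⟨f, hf, hle⟩ := C.exists_segreProjection_surjective h
  have hker : LinearMap.ker (segreProjection 5 f) = LinearMap.ker C.spanMap := by
    refine (Submodule.eq_of_le_of_finrank_eq hle ?_).symm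
    have hrank := (segreProjection 5 f).finrank_range_add_finrank_ker
    rw [LinearMap.range_eq_top.2 hf, finrank_top, Module.finrank_matrix, Module.finrank_self,
      Fintype.card_fin, Module.finrank_fin_fun] at hrank
    rw [C.finrank_ker_spanMap]
    lia
  let e := (segreProjection 5 f).quotKerEquivOfSurjective hf
  refine ⟨f, e.symm ≪≫ₗ Submodule.quotEquivOfEq _ _ hker ≪≫ₗ
    C.spanMap.quotKerEquivOfSurjective C.spanMap_surjective, fun x => ?_⟩
  have hx : e.symm (segreProjection 5 f (evalVec 5 x)) = Submodule.Quotient.mk (evalVec 5 x) :=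
    e.symm_apply_eq.2 rfl
  rw [← segreProjection_evalVec (d := 5) rfl, LinearEquiv.trans_apply, LinearEquiv.trans_apply, hx]
  exact C.spanMap_evalVec x

end SmoothRationalCurve

/-! ### Quadric surfaces and divisors of type `(1, d)` -/

section Quadric

open Matrix

variable {R n : Type*} [CommRing R] [Fintype n] [DecidableEq n]
  (A : Matrix (Fin 2) (Fin 2) R ≃ₗ[R] (n → R))

/-- The linear form whose value at `A M` is the entry `M i j`. -/
def entryForm (i j : Fin 2) : MvPolynomial n R :=
  ∑ k, C (A.symm (Pi.single k 1) i j) * X k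

/-- The equation `det = 0` of the Segre surface in the coordinates given by `A`. -/
def segreQuadric : MvPolynomial n R :=
  entryForm A 0 0 * entryForm A 1 1 - entryForm A 0 1 * entryForm A 1 0

theorem isHomogeneous_entryForm (i j : Fin 2) : (entryForm A i j).IsHomogeneous 1 :=
  IsHomogeneous.sum _ _ _ fun _ _ => isHomogeneous_C_mul_X _ _

theorem isHomogeneous_segreQuadric : (segreQuadric A).IsHomogeneous 2 :=
  ((isHomogeneous_entryForm A 0 0).mul (isHomogeneous_entryForm A 1 1)).sub
    ((isHomogeneous_entryForm A 0 1).mul (isHomogeneous_entryForm A 1 0))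

theorem eval_entryForm (x : n → R) (i j : Fin 2) : eval x (entryForm A i j) = A.symm x i j := by
  conv_rhs => rw [pi_eq_sum_univ' x, map_sum]
  simp [entryForm, Matrix.sum_apply, mul_comm]

theorem eval_segreQuadric (x : n → R) : eval x (segreQuadric A) = (A.symm x).det := by
  simp [segreQuadric, eval_entryForm, det_fin_two]

theorem pderiv_entryForm (k : n) (i j : Fin 2) :
    pderiv k (entryForm A i j) = C (A.symm (Pi.single k 1) i j) := by
  simp [entryForm, pderiv_X, Pi.single_apply]

theorem eval_pderiv_segreQuadric (k : n) (x : n → R) :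
    eval x (pderiv k (segreQuadric A)) =
      trace (adjugate (A.symm x) * A.symm (Pi.single k 1)) := by
  simp [segreQuadric, pderiv_entryForm, eval_entryForm, adjugate_fin_two, trace_fin_two, vecMul,
    dotProduct]
  ring

theorem exists_eval_pderiv_segreQuadric_ne_zero {x : n → R} (hx : x ≠ 0) :
    ∃ k, eval x (pderiv k (segreQuadric A)) ≠ 0 := by
  by_contra! h
  have htrace : ∀ N, trace (adjugate (A.symm x) * N) = 0 := by
    suffices traceLinearMap (Fin 2) R R ∘ₗ LinearMap.mulLeft R (adjugate (A.symm x)) ∘ₗ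
        A.symm.toLinearMap = 0 by
      intro N
      simpa using LinearMap.congr_fun this (A N)
    refine LinearMap.pi_ext' fun k => LinearMap.ext_ring ?_
    simpa [eval_pderiv_segreQuadric] using h k
  have hadj : adjugate (A.symm x) = 0 :=
    ext_iff_trace_mul_right.2 fun N => by rw [htrace, zero_mul, trace_zero]
  have hM : A.symm x = 0 := by
    simpa [hadj] using (adjugate_adjugate' (A.symm x)).symm
  exact hx (A.symm.map_eq_zero_iff.1 hM)

end Quadric

theorem isSmoothQuadric_segreQuadric (A : Matrix (Fin 2) (Fin 2) ℂ ≃ₗ[ℂ] (Fin 4 → ℂ)) :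
    IsSmoothQuadric (segreQuadric A) :=
  ⟨isHomogeneous_segreQuadric A, fun _ hx _ => exists_eval_pderiv_segreQuadric_ne_zero A hx⟩

theorem isSegreCoordinates_segreQuadric (A : Matrix (Fin 2) (Fin 2) ℂ ≃ₗ[ℂ] (Fin 4 → ℂ)) :
    IsSegreCoordinates (segreQuadric A) A := fun M => by
  rw [eval_segreQuadric, A.symm_apply_apply]

theorem isWeightedHomogeneous_rename {σ τ R M : Type*} [CommSemiring R] [AddCommMonoid M]
    {w : τ → M} {e : σ → τ} {p : MvPolynomial σ R} {m : M}
    (hp : p.IsWeightedHomogeneous (w ∘ e) m) : (rename e p).IsWeightedHomogeneous w m := by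
  intro b hb
  obtain ⟨a, rfl, ha⟩ := coeff_rename_ne_zero e p b hb
  rw [← hp ha, Finsupp.weight_apply, Finsupp.weight_apply]
  exact Finsupp.sum_mapDomain_index (by simp) (by simp [add_smul])

section CoprimeForms

open Matrix

variable {𝕜 : Type*} [Field 𝕜] [IsAlgClosed 𝕜] {d : ℕ} {f f' : Fin (d + 1 + 1) → 𝕜}

theorem exists_mul_add_mul_eq_of_isHomogeneous
    (h : ∀ x ≠ 0, eval x (binaryForm (d + 1) f) = 0 → eval x (binaryForm (d + 1) f') ≠ 0)
    {p : MvPolynomial (Fin 2) 𝕜} (hp : p.IsHomogeneous (d + 1 + d)) :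
    ∃ a b, binaryForm (d + 1) f * a + binaryForm (d + 1) f' * b = p := by
  have hinj : Function.Injective (sylvester (d + 1 + d) d f f').mulVecLin := by
    rw [← LinearMap.ker_eq_bot, LinearMap.ker_eq_bot']
    intro x hx
    by_contra hx₀
    obtain ⟨g, ⟨r, hr⟩, ⟨r', hr'⟩⟩ := (exists_sylvester_mulVec_eq_zero_iff (k := 1)
      (add_comm 1 d) rfl f f').1 ⟨x, hx₀, hx⟩
    obtain ⟨z, hz₀, hz⟩ := exists_eval_eq_zero_of_isHomogeneous (isHomogeneous_binaryForm g)
    exact h z hz₀ (by rw [hr, map_mul, hz, zero_mul]) (by rw [hr', map_mul, hz, zero_mul])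
  obtain ⟨p, rfl⟩ := exists_eq_binaryForm hp
  obtain ⟨x, rfl⟩ := (LinearMap.injective_iff_surjective_of_finrank_eq_finrank (by
    simp only [Module.finrank_pi, Fintype.card_sum, Fintype.card_fin]; ring)).1 hinj p
  refine ⟨binaryForm d (x ∘ Sum.inl), binaryForm d (x ∘ Sum.inr), ?_⟩
  rw [← binaryForm_sylvester_mulVec rfl, Sum.elim_comp_inl_inr, mulVecLin_apply]

theorem isRelPrime_rename_binaryForm {σ : Type*} {e : Fin 2 → σ} (he : Function.Injective e)
    (h : ∀ x ≠ 0, eval x (binaryForm (d + 1) f) = 0 → eval x (binaryForm (d + 1) f') ≠ 0) :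
    IsRelPrime (rename e (binaryForm (d + 1) f)) (rename e (binaryForm (d + 1) f')) := by
  intro p hp hp'
  have hpow : ∀ i, p ∣ X (e i) ^ (d + 1 + d) := fun i => by
    obtain ⟨a, b, hab⟩ := exists_mul_add_mul_eq_of_isHomogeneous h (isHomogeneous_X_pow i _)
    rw [← rename_X, ← map_pow, ← hab, map_add, map_mul, map_mul]
    exact dvd_add (hp.mul_right _) (hp'.mul_right _)
  have hX : IsRelPrime (X (e 0)) (X (e 1) : MvPolynomial σ 𝕜) :=
    X_prime.irreducible.isRelPrime_iff_not_dvd.2 fun hdvd =>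
      zero_ne_one (he (X_dvd_X.1 hdvd))
  exact hX.pow (hpow 0) (hpow 1)

end CoprimeForms

section Graph

variable {R 𝕜 : Type*} [CommRing R] [Field 𝕜] {d : ℕ}

/-- The form `x₀ f₁(y) - x₁ f₀(y)` of bidegree `(1, d)`, which defines the graph of
`[y] ↦ [f₀(y) : f₁(y)]`. -/
def graphForm (f : Fin 2 → Fin (d + 1) → R) : MvPolynomial (Fin 2 ⊕ Fin 2) R :=
  X (Sum.inl 0) * rename Sum.inr (binaryForm d (f 1)) -
    X (Sum.inl 1) * rename Sum.inr (binaryForm d (f 0))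

theorem eval_graphForm (f : Fin 2 → Fin (d + 1) → R) (x y : Fin 2 → R) :
    eval (Sum.elim x y) (graphForm f) =
      x 0 * eval y (binaryForm d (f 1)) - x 1 * eval y (binaryForm d (f 0)) := by
  simp [graphForm, eval_rename]

theorem isWeightedHomogeneous_graphForm {M : Type*} [AddCommMonoid M] {a b m : M}
    {f : Fin 2 → Fin (d + 1) → R}
    (hf : ∀ j, (binaryForm d (f j)).IsWeightedHomogeneous (fun _ => b) m) :
    (graphForm f).IsWeightedHomogeneous (Sum.elim (fun _ => a) fun _ => b) (a + m) := by
  set w : Fin 2 ⊕ Fin 2 → M := Sum.elim (fun _ => a) fun _ => b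
  have hX (i : Fin 2) : (X (Sum.inl i) : MvPolynomial _ R).IsWeightedHomogeneous w a :=
    isWeightedHomogeneous_X R w (Sum.inl i)
  have hrename (j : Fin 2) : (rename Sum.inr (binaryForm d (f j))).IsWeightedHomogeneous w m :=
    isWeightedHomogeneous_rename (w := w) (hf j)
  exact ((hX 0).mul (hrename 1)).sub ((hX 1).mul (hrename 0))

theorem isBihomogeneous_graphForm (f : Fin 2 → Fin (d + 1) → ℂ) :
    IsBihomogeneous (graphForm f) 1 d := by
  refine ⟨isWeightedHomogeneous_graphForm (m := 0) fun j e _ => ?_, ?_⟩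
  · simp [Finsupp.weight_apply]
  · have h := isWeightedHomogeneous_graphForm (a := 0) (b := 1) fun j =>
      isHomogeneous_binaryForm (f j)
    rwa [zero_add] at h

theorem pderiv_inl_rename_inr {σ τ S : Type*} [CommSemiring S] (i : σ) (p : MvPolynomial τ S) :
    pderiv (Sum.inl i : σ ⊕ τ) (rename Sum.inr p) = 0 := by
  classical
  refine pderiv_eq_zero_of_notMem_vars fun hi => ?_
  obtain ⟨j, -, hj⟩ := Finset.mem_image.1 (vars_rename _ _ hi)
  exact Sum.inr_ne_inl hj

theorem squarefree_graphForm [IsAlgClosed 𝕜] {f : Fin 2 → Fin (d + 1 + 1) → 𝕜}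
    (hf : ∀ x ≠ 0, (fun j => eval x (binaryForm (d + 1) (f j))) ≠ 0) :
    Squarefree (graphForm f) := by
  rintro p ⟨r, hr⟩
  have hpderiv : ∀ i, p ∣ pderiv i (graphForm f) := fun i => by
    rw [hr, mul_assoc, pderiv_mul]
    exact dvd_add ((dvd_mul_right p r).mul_left _) (dvd_mul_right p _)
  have h₁ : p ∣ rename Sum.inr (binaryForm (d + 1) (f 1)) := by
    simpa [graphForm, pderiv_inl_rename_inr, pderiv_X] using hpderiv (Sum.inl 0)
  have h₀ : p ∣ rename Sum.inr (binaryForm (d + 1) (f 0)) := by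
    simpa [graphForm, pderiv_inl_rename_inr, pderiv_X] using hpderiv (Sum.inl 1)
  refine isRelPrime_rename_binaryForm Sum.inr_injective (fun x hx hx₀ hx₁ => hf x hx ?_) h₀ h₁
  exact _root_.funext (Fin.forall_fin_two.2 ⟨hx₀, hx₁⟩)

theorem exists_smul_eq_of_vecMulVec_eq {ι κ : Type*} {u u' : ι → 𝕜} {v v' : κ → 𝕜} (hu : u ≠ 0)
    (h : Matrix.vecMulVec u v = Matrix.vecMulVec u' v') : ∃ t : 𝕜, v = t • v' := by
  obtain ⟨i, hi⟩ := Function.ne_iff.1 hu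
  refine ⟨(u i)⁻¹ * u' i, _root_.funext fun j => ?_⟩
  have hij : u i * v j = u' i * v' j := congrFun (congrFun h i) j
  rw [Pi.smul_apply, smul_eq_mul, mul_assoc, ← hij, inv_mul_cancel_left₀ hi]

end Graph

namespace SmoothRationalCurve

variable {n d : ℕ} (C : SmoothRationalCurve 3 n) {f : Fin 2 → Fin (d + 1) → ℂ}
  {A : Matrix (Fin 2) (Fin 2) ℂ ≃ₗ[ℂ] (Fin 4 → ℂ)}

theorem eval_segreQuadric_rep_eq_zero
    (hA : ∀ x, A (Matrix.vecMulVec (fun j => eval x (binaryForm d (f j))) x) = evalForms C.form x)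
    {P : PSpace 3} (hP : P ∈ C.points) : eval P.rep (segreQuadric A) = 0 := by
  obtain ⟨Q, rfl⟩ := hP
  induction Q using Projectivization.ind with
  | h x hx =>
    rw [onPoints_mk]
    obtain ⟨a, ha⟩ := Projectivization.exists_smul_eq_mk_rep ℂ _ (C.base_point_free x hx)
    rw [← ha, eval_segreQuadric, ← hA x, Units.smul_def, map_smul, A.symm_apply_apply,
      Matrix.det_smul, Matrix.det_vecMulVec, mul_zero]

theorem mk_segre_mem_points_iff
    (hA : ∀ x, A (Matrix.vecMulVec (fun j => eval x (binaryForm d (f j))) x) = evalForms C.form x)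
    {x y : Fin 2 → ℂ} (hx : x ≠ 0) (hy : y ≠ 0) (h : A (Matrix.vecMulVec x y) ≠ 0) :
    Projectivization.mk ℂ (A (Matrix.vecMulVec x y)) h ∈ C.points ↔
      eval (Sum.elim x y) (graphForm f) = 0 := by
  rw [eval_graphForm]
  constructor
  · rintro ⟨P, hP⟩
    induction P using Projectivization.ind with
    | h s hs =>
      rw [onPoints_mk, eq_comm, Projectivization.mk_eq_mk_iff'] at hP
      obtain ⟨a, ha⟩ := hP
      rw [← hA, ← map_smul, ← Matrix.vecMulVec_smul] at ha
      have hxy := A.injective ha.symm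
      have hyx := congrArg Matrix.transpose hxy
      rw [Matrix.transpose_vecMulVec, Matrix.transpose_vecMulVec] at hyx
      obtain ⟨c, hc⟩ := exists_smul_eq_of_vecMulVec_eq hy hyx
      obtain ⟨b, rfl⟩ := exists_smul_eq_of_vecMulVec_eq hx hxy
      have hpow : ∀ j, eval (b • a • s) (binaryForm d (f j)) =
          (b * a) ^ d * eval s (binaryForm d (f j)) := fun j => by
        rw [smul_smul]
        exact congrFun (evalForms_smul (fun j => isHomogeneous_binaryForm (f j)) (b * a) s) j
      simp only [hpow, hc, Pi.smul_apply, smul_eq_mul]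
      ring
  · intro hxy
    have hf : (fun j => eval y (binaryForm d (f j))) ≠ 0 := fun hf₀ =>
      C.base_point_free y hy (by rw [← hA, hf₀, Matrix.zero_vecMulVec, map_zero])
    obtain ⟨t, rfl⟩ := exists_smul_eq_of_eval_linForm_eq_zero (y := x) hf (by
      rw [eval_linForm]; linear_combination hxy)
    refine ⟨Projectivization.mk ℂ y hy, ?_⟩
    rw [onPoints_mk, eq_comm, Projectivization.mk_eq_mk_iff']
    exact ⟨t, by rw [← hA y, ← map_smul, Matrix.smul_vecMulVec]⟩

theorem isDivisorOfType_of_segre_parametrization {f : Fin 2 → Fin (d + 1 + 1) → ℂ}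
    (hA : ∀ x, A (Matrix.vecMulVec (fun j => eval x (binaryForm (d + 1) (f j))) x) =
      evalForms C.form x) :
    IsDivisorOfType (segreQuadric A) C.points 1 (d + 1) := by
  have hf : ∀ x ≠ 0, (fun j => eval x (binaryForm (d + 1) (f j))) ≠ 0 := fun x hx hf₀ =>
    C.base_point_free x hx (by rw [← hA, hf₀, Matrix.zero_vecMulVec, map_zero])
  exact ⟨fun P hP => C.eval_segreQuadric_rep_eq_zero hA hP, A, isSegreCoordinates_segreQuadric A,
    graphForm f, isBihomogeneous_graphForm f, squarefree_graphForm hf,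
    fun x y hx hy h => (C.mk_segre_mem_points_iff hA hx hy h).symm⟩

end SmoothRationalCurve

end

theorem mainTheorem12 :
    (∀ C : SmoothRationalCurve 4 5, C.Nondegenerate →
      ∃ L : LineIn 4, C.IsSecant 3 L ∧ (∀ M : LineIn 4, C.IsSecant 3 M → M = L) ∧
        ¬ C.IsSecant 4 L) ∧
    (∀ C : SmoothRationalCurve 3 5,
      IsClosed (C.secantLines 3) ∧ IsIrreducible (C.secantLines 3) ∧
        topologicalKrullDim (C.secantLines 3) = 1) ∧
    (∀ C : SmoothRationalCurve 3 5,
      (∀ L : LineIn 3, C.IsSecant 3 L → C.IsSecant 4 L) →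
        ∃ q : MvPolynomial (Fin 4) ℂ, IsSmoothQuadric q ∧ IsDivisorOfType q C.points 1 4) := by
  refine ⟨fun C hC => C.existsUnique_trisecant hC, fun C =>
    ⟨C.isClosed_secantLines C.spanMap_surjective (rfl : 3 + 2 = 5), C.isIrreducible_secantLines,
      C.topologicalKrullDim_secantLines⟩, fun C h => ?_⟩
  obtain ⟨f, A, hA⟩ := C.exists_segre_parametrization h
  exact ⟨segreQuadric A, isSmoothQuadric_segreQuadric A,
    C.isDivisorOfType_of_segre_parametrization (d := 3) hA⟩
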